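/- Let $(S,\mathfrak n)$ be a regular local ring and let $x,y\in\mathfrak n$ with $xy\neq 0$. Suppose that the ideal $(x,y)$ of $S$ is neither prime nor $\mathfrak n$-primary. Then the hypersurface $R=S/(xy)$ has infinite $\mathsf{CM}_+$-representation type; that is, there are infinitely many isomorphism classes of indecomposable maximal Cohen–Macaulay $R$-modules that are not locally free on the punctured spectrum of $R$. (Here a finitely generated $R$-module $M$ is maximal Cohen–Macaulay if $\operatorname{depth} M_{\mathfrak p}\ge\dim R_{\mathfrak p}$ for all $\mathfrak p\in\operatorname{Spec}R$, the zero module having depth $\infty$; and $M$ is locally free on the punctured spectrum if $M_{\mathfrak p}$ is a free $R_{\mathfrak p}$-module for every prime $\mathfrak p$ other than the maximal ideal.) -/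

import Mathlib

universe u

open CategoryTheory RingTheory.Sequence IsLocalRing

/-- The depth of a finitely generated module `M` over a Noetherian local ring `A`: the supremum of
the lengths of the `M`-regular sequences in the maximal ideal. For `M ≠ 0` finitely generated,
Nakayama's lemma makes every weakly regular sequence in the maximal ideal regular; the zero module
gets depth `∞`, which is the usual convention. -/
noncomputable def localDepth (A : Type*) [CommRing A] [IsLocalRing A]
    (M : Type*) [AddCommGroup M] [Module A M] : ℕ∞ :=
  ⨆ (rs : List A) (_ : (∀ r ∈ rs, r ∈ maximalIdeal A) ∧ IsWeaklyRegular M rs), (rs.length : ℕ∞)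

/-- A finitely generated `R`-module `M` is maximal Cohen-Macaulay if
`depth M_p ≥ dim R_p` for every prime ideal `p` of `R`. The zero module is included. -/
def IsMaximalCM (R : Type*) [CommRing R] (M : Type*) [AddCommGroup M] [Module R M] : Prop :=
  Module.Finite R M ∧ ∀ (p : Ideal R) [p.IsPrime],
    ringKrullDim (Localization.AtPrime p) ≤
      (localDepth (Localization.AtPrime p) (LocalizedModule p.primeCompl M) : WithBot ℕ∞)

/-- A module over a local ring is locally free on the punctured spectrum if its localization at
every prime ideal other than the maximal ideal is free. (Here "other than the maximal ideal" is
expressed as "not a maximal ideal", which is the same thing in a local ring.) -/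
def IsLocallyFreeOnPunctured (R : Type*) [CommRing R]
    (M : Type*) [AddCommGroup M] [Module R M] : Prop :=
  ∀ (p : Ideal R) [p.IsPrime], ¬ p.IsMaximal →
    Module.Free (Localization.AtPrime p) (LocalizedModule p.primeCompl M)

/-- The maximal Cohen-Macaulay modules that are not locally free on the punctured spectrum. -/
def IsCMPlus (R : Type*) [CommRing R] (M : Type*) [AddCommGroup M] [Module R M] : Prop :=
  IsMaximalCM R M ∧ ¬ IsLocallyFreeOnPunctured R M

/-- A module is indecomposable if it is nonzero and is not the direct sum of two nonzero
submodules. -/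
def IsIndecomposableModule (R : Type*) [CommRing R] (M : Type*) [AddCommGroup M] [Module R M] :
    Prop :=
  Nontrivial M ∧ ∀ N N' : Submodule R M, IsCompl N N' → N = ⊥ ∨ N' = ⊥

/-- The set of isomorphism classes of indecomposable `R`-modules in `CM₊(R)`. (Every finitely
generated module over `R : Type u` is isomorphic to one in `Type u`.) -/
def indCMPlus (R : Type u) [CommRing R] : Set (Quotient (isIsomorphicSetoid (ModuleCat.{u} R))) :=
  {c | ∃ M : ModuleCat.{u} R, IsIndecomposableModule R M ∧ IsCMPlus R M ∧ c = Quotient.mk _ M}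

/-- Finite `CM₊`-representation type: there are only finitely many isomorphism classes of
indecomposable modules in `CM₊(R)`. -/
def HasFiniteCMPlusType (R : Type u) [CommRing R] : Prop :=
  (indCMPlus R).Finite

/-- Infinite `CM₊`-representation type. -/
def HasInfiniteCMPlusType (R : Type u) [CommRing R] : Prop :=
  ¬ HasFiniteCMPlusType R

/-! ### Regular local rings: hyperplane sections and integrality. -/

section RegularLocal

variable {S : Type u} [CommRing S]

/-! Put I = (x, y) and f = xy. Over the domain S, a matrix factorization φψ = ψφ = f makes coker φ
over R the cokernel in a 2-periodic exact complex of free modules. Weakly regular sequences on R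
therefore stay weakly regular on it (`IsWeaklyRegular.of_periodic`), so it is maximal Cohen–Macaulay
(`MatrixCoker.isMaximalCM`). Maps of cokernels lift to matrices, so indecomposability becomes a
determinant condition, and the ideal of entries of a reduced φ is an isomorphism invariant. It
remains to write down a family with infinitely many entry ideals
(`hasInfiniteCMPlusType_of_matrix_family`).

If some nonmaximal prime P ⊇ I contains z with z·w^k ∉ I for all k and some w ∈ 𝔫, use the matrices
with rows (x, z·w^k), (0, y), for large k. Their entries lie in P, so the cokernels are not free at
P.

Otherwise, every element of a nonmaximal prime over I is multiplied into I by a power of each w ∈ 𝔫.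
There is then exactly one such prime P, and since I is not prime, S/I has a nonzero element
supported at the closed point. Depth counting (`not_hasDepthGE_three`) forces dim S = 2, so P = (g),
x = ga, y = gb with a, b in 𝔫 and without common factor. The 3 × 3 matrices with rows (g, w^k, w^k),
(0, ga, 0), (0, 0, gb), where w ∈ 𝔫 \ (g) and k ≥ 1, then do the job. -/

/-- An element of the maximal ideal outside its square is part of a minimal generating set. -/
theorem spanFinrank_maximalIdeal_quotient_succ_le [IsLocalRing S] [IsNoetherianRing S] {x : S}
    (hx : x ∈ maximalIdeal S) (hx2 : x ∉ maximalIdeal S ^ 2) [IsLocalRing (S ⧸ Ideal.span {x})] :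
    (maximalIdeal (S ⧸ Ideal.span {x})).spanFinrank + 1 ≤ (maximalIdeal S).spanFinrank := by
  classical
  have hfg : (maximalIdeal S).FG := IsNoetherian.noetherian _
  have hfin := Submodule.FG.finite_generators hfg
  set s : Finset S := hfin.toFinset with hs
  have hspan : Ideal.span (s : Set S) = maximalIdeal S := by
    rw [hs, Set.Finite.coe_toFinset]; exact (maximalIdeal S).span_generators
  have hcard : s.card = (maximalIdeal S).spanFinrank := by
    rw [← Submodule.FG.generators_ncard hfg, Set.ncard_eq_toFinset_card _ hfin]
  have hx' := hx
  rw [← hspan] at hx'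
  obtain ⟨c, -, hc⟩ := Submodule.mem_span_finset.mp hx'
  -- As x ∉ 𝔪², some coefficient of x on the minimal generators is a unit. Modulo x, that generator
  -- is a combination of the others.
  obtain ⟨i, his, hi⟩ : ∃ i ∈ s, c i ∉ maximalIdeal S := by
    by_contra! h
    apply hx2
    rw [← hc, pow_two]
    refine Ideal.sum_mem _ fun i hi ↦ Ideal.mul_mem_mul (h i hi) ?_
    rw [← hspan]; exact Ideal.subset_span hi
  have hu : IsUnit (c i) := by simpa using hi
  obtain ⟨u, hu⟩ := hu
  have hmap : (maximalIdeal S).map (Ideal.Quotient.mk (Ideal.span {x})) =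
      maximalIdeal (S ⧸ Ideal.span {x}) := by
    apply IsLocalRing.eq_maximalIdeal
    refine Ideal.map_eq_top_or_isMaximal_of_surjective _ Ideal.Quotient.mk_surjective
      (maximalIdeal.isMaximal S) |>.resolve_left fun h ↦ ?_
    have := Ideal.comap_map_of_surjective _ (Ideal.Quotient.mk_surjective (I := Ideal.span {x}))
      (maximalIdeal S)
    rw [h, Ideal.comap_top, ← RingHom.ker_eq_comap_bot, Ideal.mk_ker, sup_eq_left.mpr] at this
    · exact (maximalIdeal.isMaximal S).ne_top this.symm
    · simpa [Ideal.span_singleton_le_iff_mem] using hx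
  have hle : maximalIdeal (S ⧸ Ideal.span {x}) =
      Ideal.span ((s.erase i).image (Ideal.Quotient.mk (Ideal.span {x})) : Finset _) := by
    rw [← hmap]
    apply le_antisymm
    · rw [← hspan, Ideal.map_span, Ideal.span_le]
      have key : ∀ j ∈ s.erase i, Ideal.Quotient.mk (Ideal.span {x}) j ∈
          Ideal.span (((s.erase i).image (Ideal.Quotient.mk (Ideal.span {x})) : Finset _) :
            Set (S ⧸ Ideal.span {x})) := fun j hj ↦
        Ideal.subset_span (Finset.mem_coe.mpr (Finset.mem_image_of_mem _ hj))
      rintro _ ⟨j, hj, rfl⟩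
      by_cases hji : j = i
      · subst hji
        have h1 : j = ↑u⁻¹ * (x - ∑ k ∈ s.erase j, c k • k) := by
          rw [← hc, ← Finset.add_sum_erase _ _ his, ← hu]
          simp
        have h2 := congrArg (Ideal.Quotient.mk (Ideal.span {x})) h1
        rw [h2]
        clear h1 h2
        simp only [map_mul, map_sub, map_sum, smul_eq_mul,
          Ideal.Quotient.eq_zero_iff_mem.mpr (Ideal.mem_span_singleton_self x), zero_sub]
        exact Ideal.mul_mem_left _ _ (neg_mem (Ideal.sum_mem _ fun k hk ↦
          Ideal.mul_mem_left _ _ (key k hk)))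
      · exact key j (by simpa [hji] using hj)
    · rw [Ideal.span_le]
      intro _ hj
      simp only [Finset.coe_image, Set.mem_image] at hj
      obtain ⟨j, hj, rfl⟩ := hj
      apply Ideal.mem_map_of_mem
      rw [← hspan]
      exact Ideal.subset_span (Finset.mem_of_mem_erase hj)
  rw [hle, ← hcard, ← Finset.card_erase_add_one his]
  gcongr
  refine (Submodule.spanFinrank_span_le_ncard_of_finite (Finset.finite_toSet _)).trans ?_
  rw [Set.ncard_coe_finset]
  exact Finset.card_image_le

theorem isLocalRing_quotient_span_singleton [IsLocalRing S] {x : S} (hx : x ∈ maximalIdeal S) :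
    IsLocalRing (S ⧸ Ideal.span {x}) := by
  have : Nontrivial (S ⧸ Ideal.span {x}) := Ideal.Quotient.nontrivial_iff.mpr fun h ↦ by
    rw [Ideal.span_singleton_eq_top] at h
    exact hx h
  exact .of_surjective' _ Ideal.Quotient.mk_surjective

theorem ringKrullDim_le_quotient_span_singleton_succ [IsLocalRing S] [IsNoetherianRing S] {x : S}
    (hx : x ∈ maximalIdeal S) : ringKrullDim S ≤ ringKrullDim (S ⧸ Ideal.span {x}) + 1 := by
  have := ringKrullDim_le_ringKrullDim_quotient_add_encard {x}
    (by simpa [IsLocalRing.ringJacobson_eq_maximalIdeal] using hx)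
  simpa using this

/-- Cutting a regular local ring by an element of `𝔪 \ 𝔪²` gives a regular local ring. -/
theorem isRegularLocalRing_quotient_span_singleton [IsRegularLocalRing S] {x : S}
    (hx : x ∈ maximalIdeal S) (hx2 : x ∉ maximalIdeal S ^ 2) :
    IsRegularLocalRing (S ⧸ Ideal.span {x}) := by
  have := isLocalRing_quotient_span_singleton hx
  apply IsRegularLocalRing.of_spanFinrank_maximalIdeal_le
  have h1 := spanFinrank_maximalIdeal_quotient_succ_le hx hx2
  have h2 := ringKrullDim_le_quotient_span_singleton_succ hx
  rw [← (isRegularLocalRing_iff S).mp ‹_›] at h2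
  have h3 : (((maximalIdeal (S ⧸ Ideal.span {x})).spanFinrank : WithBot ℕ∞)) + 1 ≤
    ringKrullDim (S ⧸ Ideal.span {x}) + 1 := le_trans (by exact_mod_cast h1) h2
  have h4 := ringKrullDim_nonneg_of_nontrivial (R := S ⧸ Ideal.span {x})
  cases h : ringKrullDim (S ⧸ Ideal.span {x}) with
  | bot => simp [h] at h4
  | coe d =>
    rw [h] at h3
    have h5 : (((maximalIdeal (S ⧸ Ideal.span {x})).spanFinrank : ℕ∞)) + 1 ≤ d + 1 := by
      exact_mod_cast h3
    have h6 := (ENat.add_le_add_iff_right (by simp : (1 : ℕ∞) ≠ ⊤)).mp h5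
    exact_mod_cast h6

/-- Prime avoidance tolerates a nonprime member, here 𝔪². Nakayama rules out 𝔪 ≤ 𝔪², and 𝔪 inside a
minimal prime would force dimension zero, hence 𝔪 = 0. -/
theorem exists_mem_maximalIdeal_notMem_sq [IsRegularLocalRing S] (h : maximalIdeal S ≠ ⊥) :
    ∃ x ∈ maximalIdeal S, x ∉ maximalIdeal S ^ 2 ∧ ∀ q ∈ minimalPrimes S, x ∉ q := by
  classical
  by_contra! H
  have hfin : (minimalPrimes S).Finite := minimalPrimes.finite_of_isNoetherianRing S
  have hsub : (maximalIdeal S : Set S) ⊆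
      ⋃ i ∈ ((insert (maximalIdeal S ^ 2) hfin.toFinset : Finset (Ideal S)) : Set (Ideal S)),
        ((id i : Ideal S) : Set S) := by
    intro x hx
    by_cases hx2 : x ∈ maximalIdeal S ^ 2
    · exact Set.mem_biUnion (x := maximalIdeal S ^ 2) (by simp) hx2
    · obtain ⟨q, hq, hxq⟩ := H x hx hx2
      exact Set.mem_biUnion (x := q) (by simp [hq]) hxq
  rw [Ideal.subset_union_prime (maximalIdeal S ^ 2) (maximalIdeal S ^ 2)] at hsub
  · obtain ⟨q, hq, hle⟩ := hsub
    rw [Finset.mem_insert, Set.Finite.mem_toFinset] at hq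
    rcases hq with rfl | hq
    · apply h
      refine Submodule.eq_bot_of_le_smul_of_le_jacobson_bot (maximalIdeal S) _
        (IsNoetherian.noetherian _) ?_ (maximalIdeal_le_jacobson _)
      simpa [pow_two] using hle
    · have hqp : q.IsPrime := hq.1.1
      have h1 : maximalIdeal S = q := le_antisymm hle (le_maximalIdeal hqp.ne_top)
      have h2 : (maximalIdeal S).height = 0 := by
        rw [Ideal.height_eq_zero_iff, h1]; exact hq
      have h3 := (isRegularLocalRing_iff S).mp ‹_›
      rw [← maximalIdeal_height_eq_ringKrullDim, h2] at h3
      have h4 : (maximalIdeal S).spanFinrank = 0 := by exact_mod_cast h3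
      exact h ((Submodule.spanFinrank_eq_zero_iff_eq_bot (IsNoetherian.noetherian _)).mp h4)
  · intro i hi h1 _
    rw [Finset.mem_insert, Set.Finite.mem_toFinset] at hi
    exact (hi.resolve_left h1).1.1

/-- If `x` lies in the maximal ideal but in no minimal prime, and `S ⧸ (x)` is a domain,
then so is `S`. -/
theorem isDomain_of_isDomain_quotient [IsLocalRing S] [IsNoetherianRing S] {x : S}
    (hx : x ∈ maximalIdeal S) (hxq : ∀ q ∈ minimalPrimes S, x ∉ q)
    [IsDomain (S ⧸ Ideal.span {x})] : IsDomain S := by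
  have hp : (Ideal.span {x}).IsPrime := (Ideal.Quotient.isDomain_iff_prime _).mp ‹_›
  obtain ⟨q, hq, hqx⟩ := Ideal.exists_minimalPrimes_le (bot_le : ⊥ ≤ Ideal.span {x})
  have hqp : q.IsPrime := hq.1.1
  -- A minimal prime q inside (x) avoids x, so q = xq and Nakayama gives q = 0.
  have hq0 : q = ⊥ := by
    refine Submodule.eq_bot_of_le_smul_of_le_jacobson_bot (maximalIdeal S) _
      (IsNoetherian.noetherian _) (fun a ha ↦ ?_) (maximalIdeal_le_jacobson _)
    obtain ⟨b, rfl⟩ := Ideal.mem_span_singleton.mp (hqx ha)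
    exact Submodule.smul_mem_smul hx ((hqp.mem_or_mem ha).resolve_left (hxq q hq))
  rw [hq0] at hqp
  exact (IsDomain.of_bot_isPrime S)

theorem isDomain_of_spanFinrank_eq (d : ℕ) : ∀ (S : Type u) [CommRing S] [IsRegularLocalRing S],
    (maximalIdeal S).spanFinrank = d → IsDomain S := by
  induction d with
  | zero =>
    intro S _ _ h
    have h0 := (Submodule.spanFinrank_eq_zero_iff_eq_bot (IsNoetherian.noetherian _)).mp h
    exact (isField_iff_maximalIdeal_eq.mpr h0).isDomain
  | succ d ih =>
    intro S _ _ h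
    have h0 : maximalIdeal S ≠ ⊥ := fun h0 ↦ by simp [h0] at h
    obtain ⟨x, hx, hx2, hxq⟩ := exists_mem_maximalIdeal_notMem_sq h0
    have := isRegularLocalRing_quotient_span_singleton hx hx2
    have h1 := spanFinrank_maximalIdeal_quotient_succ_le hx hx2
    have h2 := (isRegularLocalRing_iff S).mp ‹_›
    have h3 := (isRegularLocalRing_iff (S ⧸ Ideal.span {x})).mp ‹_›
    have h4 := ringKrullDim_le_quotient_span_singleton_succ hx
    rw [← h2, ← h3] at h4
    have h5 : (maximalIdeal S).spanFinrank ≤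
      (maximalIdeal (S ⧸ Ideal.span {x})).spanFinrank + 1 := by exact_mod_cast h4
    have := ih (S ⧸ Ideal.span {x}) (by omega)
    exact isDomain_of_isDomain_quotient hx hxq

instance (priority := low) IsRegularLocalRing.isDomain [IsRegularLocalRing S] : IsDomain S :=
  isDomain_of_spanFinrank_eq _ S rfl

end RegularLocal

/-! ### Depth, associated primes and Cohen–Macaulay local rings. -/

section Depth

open Abelian Limits Pointwise

/-- There is an `M`-regular sequence of length `n` in the maximal ideal. -/
def HasDepthGE (A : Type*) [CommRing A] [IsLocalRing A] (M : Type*) [AddCommGroup M] [Module A M]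
    (n : ℕ) : Prop :=
  ∃ rs : List A, rs.length = n ∧ (∀ r ∈ rs, r ∈ maximalIdeal A) ∧ RingTheory.Sequence.IsRegular M rs

theorem maximalIdeal_smul_top_lt_top {A : Type*} [CommRing A] [IsLocalRing A]
    (M : Type*) [AddCommGroup M] [Module A M] [Module.Finite A M] [Nontrivial M] :
    maximalIdeal A • (⊤ : Submodule A M) < ⊤ := by
  refine lt_top_iff_ne_top.mpr fun h ↦ ?_
  have := Submodule.eq_bot_of_le_smul_of_le_jacobson_bot (maximalIdeal A) (⊤ : Submodule A M)
    Module.Finite.fg_top h.ge (maximalIdeal_le_jacobson _)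
  exact top_ne_bot this

/-- The element f need not belong to the given regular sequence. Depth is read off from vanishing of
Ext, which loses one degree in the long exact sequence of multiplication by f. -/
theorem HasDepthGE.quotSMulTop {A : Type u} [CommRing A] [IsLocalRing A] [IsNoetherianRing A]
    {M : Type u} [AddCommGroup M] [Module A M] [Module.Finite A M] {n : ℕ}
    (h : HasDepthGE A M (n + 1)) {f : A} (hf : f ∈ maximalIdeal A) (hreg : IsSMulRegular M f) :
    HasDepthGE A (QuotSMulTop f M) n := by
  have hnt : Nontrivial M := by
    obtain ⟨rs, -, -, h⟩ := h
    exact h.nontrivial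
  have hnt' : Nontrivial (QuotSMulTop f M) := nontrivial_quotSMulTop_of_mem_maximalIdeal M hf
  have h1 := ((ModuleCat.exists_isRegular_tfae (maximalIdeal A) (n + 1) (ModuleCat.of A M)
    (maximalIdeal_smul_top_lt_top M)).out 1 3).mpr h
  refine ((ModuleCat.exists_isRegular_tfae (maximalIdeal A) n (ModuleCat.of A (QuotSMulTop f M))
    (maximalIdeal_smul_top_lt_top _)).out 1 3).mp ?_
  intro i hi
  have hreg' : IsSMulRegular (ModuleCat.of A M) f := hreg
  have zero1 := AddCommGrpCat.isZero_of_iff_subsingleton.mpr (h1 i (by omega))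
  have zero2 := AddCommGrpCat.isZero_of_iff_subsingleton.mpr (h1 (i + 1) (by omega))
  exact AddCommGrpCat.subsingleton_of_isZero <| ShortComplex.Exact.isZero_of_both_zeros
    ((Ext.covariant_sequence_exact₃' _ hreg'.smulShortComplex_shortExact) i (i + 1) rfl)
    (zero1.eq_zero_of_src _) (zero2.eq_zero_of_tgt _)

/-- Let N be the submodule killed by q. If N ≤ rM, regularity of r gives N = rN, so N = 0 by
Nakayama, which is absurd. An element of N outside rM has annihilator modulo r containing q and r,
while r ∉ q. -/
theorem IsAssociatedPrime.exists_lt_of_isSMulRegular {A : Type*} [CommRing A] [IsLocalRing A]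
    [IsNoetherianRing A] {M : Type*} [AddCommGroup M] [Module A M] [Module.Finite A M]
    {q : Ideal A} (hq : IsAssociatedPrime q M) {r : A} (hr : r ∈ maximalIdeal A)
    (hreg : IsSMulRegular M r) : ∃ q', IsAssociatedPrime q' (QuotSMulTop r M) ∧ q < q' := by
  obtain ⟨hqp, x, hx⟩ := isAssociatedPrime_iff.mp hq
  have hmem : ∀ a, a ∈ q ↔ a • x = 0 := fun a ↦ by
    rw [hx, Submodule.mem_colon_singleton, Submodule.mem_bot]
  have hx0 : x ≠ 0 := fun h ↦ hqp.ne_top (by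
    rw [Ideal.eq_top_iff_one, hmem, h, smul_zero])
  let N : Submodule A M := ⨅ a : q, LinearMap.ker (LinearMap.lsmul A M a.1)
  have hN : ∀ m, m ∈ N ↔ ∀ a ∈ q, a • m = 0 := fun m ↦ by simp [N]
  obtain ⟨y, hyN, hy⟩ : ∃ y ∈ N, y ∉ r • (⊤ : Submodule A M) := by
    by_contra! H
    have hbot : N = ⊥ := by
      refine Submodule.eq_bot_of_le_smul_of_le_jacobson_bot (maximalIdeal A) _
        (IsNoetherian.noetherian _) (fun y hy ↦ ?_) (maximalIdeal_le_jacobson _)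
      obtain ⟨z, -, rfl⟩ := H y hy
      refine Submodule.smul_mem_smul hr ((hN _).mpr fun a ha ↦ hreg ?_)
      have := (hN _).mp hy a ha
      simpa [smul_comm r a] using this
    have : x ∈ N := (hN _).mpr fun a ha ↦ (hmem a).mp ha
    rw [hbot] at this
    exact hx0 this
  obtain ⟨q', hq', hle⟩ := exists_le_isAssociatedPrime_of_isNoetherianRing A
    (Submodule.Quotient.mk (p := r • (⊤ : Submodule A M)) y)
    (by rwa [Ne, Submodule.Quotient.mk_eq_zero])
  refine ⟨q', hq', lt_of_le_of_ne (fun a ha ↦ hle ?_) fun h ↦ ?_⟩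
  · rw [Submodule.mem_colon_singleton, Submodule.mem_bot, ← Submodule.Quotient.mk_smul,
      (hN _).mp hyN a ha, Submodule.Quotient.mk_zero]
  · have hrq' : r ∈ q' := hle (by
      rw [Submodule.mem_colon_singleton, Submodule.mem_bot, ← Submodule.Quotient.mk_smul,
        Submodule.Quotient.mk_eq_zero]
      exact Submodule.smul_mem_pointwise_smul y r ⊤ trivial)
    rw [← h, hmem] at hrq'
    exact hx0 (hreg (by simpa using hrq'))

theorem IsAssociatedPrime.height_add_length_le {A : Type*} [CommRing A] [IsLocalRing A]
    [IsNoetherianRing A] (rs : List A) (hrs : ∀ r ∈ rs, r ∈ maximalIdeal A) :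
    ∀ {M : Type*} [AddCommGroup M] [Module A M] [Module.Finite A M]
    {q : Ideal A}, IsAssociatedPrime q M → IsWeaklyRegular M rs →
    q.height + rs.length ≤ (maximalIdeal A).height := by
  induction rs with
  | nil =>
    intro M _ _ _ q hq _
    simpa using Ideal.height_mono (le_maximalIdeal hq.isPrime.ne_top)
  | cons r rs ih =>
    intro M _ _ _ q hq h
    rw [isWeaklyRegular_cons_iff] at h
    obtain ⟨q', hq', hlt⟩ := hq.exists_lt_of_isSMulRegular (hrs r (by simp)) h.1
    have h1 := ih (fun a ha ↦ hrs a (by simp [ha])) hq' h.2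
    have := hq.isPrime
    have := hq'.isPrime
    have h2 := Ideal.height_add_one_le_of_lt_of_isPrime hlt
    calc q.height + ((r :: rs).length : ℕ∞) = (q.height + 1) + rs.length := by
          push_cast [List.length_cons]; ring
      _ ≤ q'.height + rs.length := by gcongr
      _ ≤ _ := h1

/-- `QuotSMulTop x A` is the quotient ring `A ⧸ (x)`. -/
noncomputable def quotSMulTopSelfEquiv {A : Type*} [CommRing A] (x : A) :
    QuotSMulTop x A ≃ₗ[A] A ⧸ Ideal.span {x} :=
  Submodule.quotEquivOfEq _ _ (by
    rw [← Submodule.ideal_span_singleton_smul, smul_eq_mul, Ideal.mul_top])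

theorem isWeaklyRegular_quotient_span_singleton_iff {A : Type*} [CommRing A] (x : A)
    (rs : List A) : IsWeaklyRegular (A ⧸ Ideal.span {x}) (rs.map (Ideal.Quotient.mk (.span {x}))) ↔
      IsWeaklyRegular (QuotSMulTop x A) rs := by
  rw [(quotSMulTopSelfEquiv x).isWeaklyRegular_congr]
  exact isWeaklyRegular_map_algebraMap_iff (A ⧸ Ideal.span {x}) (A ⧸ Ideal.span {x}) rs

theorem mk_mem_maximalIdeal_iff {A : Type*} [CommRing A] [IsLocalRing A] {I : Ideal A}
    [IsLocalRing (A ⧸ I)] (a : A) :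
    Ideal.Quotient.mk I a ∈ maximalIdeal (A ⧸ I) ↔ a ∈ maximalIdeal A := by
  have := IsLocalHom.of_surjective (Ideal.Quotient.mk I) Ideal.Quotient.mk_surjective
  simp

theorem HasDepthGE.quotient_span_singleton {A : Type u} [CommRing A] [IsLocalRing A]
    [IsNoetherianRing A] {n : ℕ} (h : HasDepthGE A A (n + 1)) {f : A} (hf : f ∈ maximalIdeal A)
    (hreg : IsSMulRegular A f) [IsLocalRing (A ⧸ Ideal.span {f})] :
    HasDepthGE (A ⧸ Ideal.span {f}) (A ⧸ Ideal.span {f}) n := by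
  obtain ⟨rs, hlen, hmem, h⟩ := h.quotSMulTop hf hreg
  have hmem' : ∀ r ∈ rs.map (Ideal.Quotient.mk (.span {f})),
      r ∈ maximalIdeal (A ⧸ Ideal.span {f}) := by
    intro r hr
    obtain ⟨a, ha, rfl⟩ := List.mem_map.mp hr
    exact (mk_mem_maximalIdeal_iff a).mpr (hmem a ha)
  refine ⟨rs.map (Ideal.Quotient.mk (.span {f})), by simpa using hlen, hmem', ?_⟩
  exact (isRegular_iff_isWeaklyRegular_of_subset_maximalIdeal hmem').mpr
    ((isWeaklyRegular_quotient_span_singleton_iff f rs).mpr h.toIsWeaklyRegular)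

theorem exists_map_mk_eq {A : Type*} [CommRing A] {I : Ideal A} (p : Ideal A)
    (rs : List (A ⧸ I)) (h : ∀ r ∈ rs, r ∈ p.map (Ideal.Quotient.mk I)) :
    ∃ rs' : List A, rs'.map (Ideal.Quotient.mk I) = rs ∧ ∀ r ∈ rs', r ∈ p := by
  induction rs with
  | nil => exact ⟨[], by simp⟩
  | cons r rs ih =>
    obtain ⟨rs', h1, h2⟩ := ih fun a ha ↦ h a (by simp [ha])
    obtain ⟨a, ha, hra⟩ := (Ideal.mem_map_iff_of_surjective _ Ideal.Quotient.mk_surjective).mp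
      (h r (by simp))
    exact ⟨a :: rs', by simp [h1, hra], by simpa using ⟨ha, h2⟩⟩

/-- A Noetherian local ring whose depth is its dimension. -/
def IsCMLocal (A : Type*) [CommRing A] [IsLocalRing A] : Prop :=
  ∃ n : ℕ, ringKrullDim A = n ∧ HasDepthGE A A n

theorem IsCMLocal.quotient_span_singleton {A : Type u} [CommRing A] [IsLocalRing A]
    [IsNoetherianRing A] (h : IsCMLocal A) {f : A} (hf : f ∈ maximalIdeal A)
    (hreg : IsSMulRegular A f) [IsLocalRing (A ⧸ Ideal.span {f})] :
    IsCMLocal (A ⧸ Ideal.span {f}) := by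
  obtain ⟨n, hn, h⟩ := h
  have hdim := ringKrullDim_quotient_span_singleton_succ_eq_ringKrullDim hreg hf
  have h0 := ringKrullDim_nonneg_of_nontrivial (R := A ⧸ Ideal.span {f})
  rw [hn] at hdim
  cases hd : ringKrullDim (A ⧸ Ideal.span {f}) with
  | bot => simp [hd] at h0
  | coe d =>
    rw [hd] at hdim
    have hd' : d + 1 = (n : ℕ∞) := by exact_mod_cast hdim
    have hdt : d ≠ ⊤ := by rintro rfl; simp at hd'
    obtain ⟨m, rfl⟩ := ENat.ne_top_iff_exists.mp hdt
    have hmn : m + 1 = n := by exact_mod_cast hd'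
    subst hmn
    exact ⟨m, by rw [hd]; rfl, h.quotient_span_singleton hf hreg⟩

/-- Each term of a regular sequence of length dim A moves q to a strictly larger prime, which uses
up the whole height of 𝔪. -/
theorem IsCMLocal.height_eq_zero_of_isAssociatedPrime {A : Type u} [CommRing A] [IsLocalRing A]
    [IsNoetherianRing A] (h : IsCMLocal A) {q : Ideal A} (hq : IsAssociatedPrime q A) :
    q.height = 0 := by
  obtain ⟨n, hn, rs, hlen, hmem, hreg⟩ := h
  have h1 := IsAssociatedPrime.height_add_length_le rs hmem hq hreg.toIsWeaklyRegular
  rw [← maximalIdeal_height_eq_ringKrullDim] at hn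
  have h2 : (maximalIdeal A).height = n := by exact_mod_cast hn
  rw [h2, hlen] at h1
  have h3 : q.height + n ≤ 0 + n := by simpa using h1
  simpa using (ENat.add_le_add_iff_right (ENat.natCast_ne_top n)).mp h3

/-- Associated primes have height zero, so a prime of positive height contains a regular element by
prime avoidance. Dividing by it keeps the ring Cohen–Macaulay and lowers the height of p by at most
one. -/
theorem IsCMLocal.exists_isWeaklyRegular (h : ℕ) : ∀ {A : Type u} [CommRing A] [IsLocalRing A]
    [IsNoetherianRing A], IsCMLocal A → ∀ (p : Ideal A) [p.IsPrime], h ≤ p.height →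
    ∃ rs : List A, rs.length = h ∧ (∀ r ∈ rs, r ∈ p) ∧ IsWeaklyRegular A rs := by
  induction h with
  | zero => intro A _ _ _ _ p _ _; exact ⟨[], by simp⟩
  | succ h ih =>
    intro A _ _ _ hA p hp hph
    obtain ⟨r, hrp, hr⟩ : ∃ r ∈ p, IsSMulRegular A r := by
      by_contra! H
      have hsub : (p : Set A) ⊆ ⋃ q ∈ ((associatedPrimes.finite A A).toFinset : Set (Ideal A)),
          ((id q : Ideal A) : Set A) := by
        intro r hr
        have : r ∈ ({r | IsSMulRegular A r}ᶜ : Set A) := H r hr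
        rw [← biUnion_associatedPrimes_eq_compl_regular] at this
        simpa using this
      rw [Ideal.subset_union_prime ⊥ ⊥ (fun q hq _ _ ↦ by
        rw [Set.Finite.mem_toFinset] at hq; exact hq.isPrime)] at hsub
      obtain ⟨q, hq, hpq⟩ := hsub
      rw [Set.Finite.mem_toFinset] at hq
      have h1 := hA.height_eq_zero_of_isAssociatedPrime hq
      have h2 := (hph.trans (Ideal.height_mono hpq)).trans_eq h1
      simp at h2
    have hrm : r ∈ maximalIdeal A := le_maximalIdeal hp.ne_top hrp
    have := isLocalRing_quotient_span_singleton hrm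
    have hle : Ideal.span {r} ≤ p := by simpa [Ideal.span_singleton_le_iff_mem] using hrp
    have hp' : (p.map (Ideal.Quotient.mk (Ideal.span {r}))).IsPrime :=
      Ideal.isPrime_map_quotientMk_of_isPrime hle
    have hh : (h : ℕ∞) ≤ (p.map (Ideal.Quotient.mk (Ideal.span {r}))).height := by
      have h1 := hph.trans (Ideal.height_le_height_add_one_of_mem hrp)
      push_cast at h1
      exact (ENat.add_le_add_iff_right (by simp : (1 : ℕ∞) ≠ ⊤)).mp h1
    obtain ⟨rs, hlen, hmem, hreg⟩ := ih (hA.quotient_span_singleton hrm hr) _ hh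
    obtain ⟨rs', rfl, hmem'⟩ := exists_map_mk_eq p rs hmem
    refine ⟨r :: rs', by simpa using hlen, by simpa using ⟨hrp, hmem'⟩, ?_⟩
    rw [isWeaklyRegular_cons_iff]
    exact ⟨hr, (isWeaklyRegular_quotient_span_singleton_iff r rs').mp hreg⟩

theorem isCMLocal_of_quotient {A : Type u} [CommRing A] [IsLocalRing A]
    [IsNoetherianRing A] {f : A} (hf : f ∈ maximalIdeal A)
    (hreg : IsSMulRegular A f) [IsLocalRing (A ⧸ Ideal.span {f})]
    (h : IsCMLocal (A ⧸ Ideal.span {f})) : IsCMLocal A := by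
  obtain ⟨n, hn, rs, hlen, hmem, h⟩ := h
  have hdim := ringKrullDim_quotient_span_singleton_succ_eq_ringKrullDim hreg hf
  obtain ⟨rs', rfl, hmem'⟩ := exists_map_mk_eq (maximalIdeal A) rs fun r hr ↦ by
    obtain ⟨a, rfl⟩ := Ideal.Quotient.mk_surjective r
    exact Ideal.mem_map_of_mem _ ((mk_mem_maximalIdeal_iff a).mp (hmem _ hr))
  have hmem2 : ∀ r ∈ f :: rs', r ∈ maximalIdeal A := by simpa using ⟨hf, hmem'⟩
  refine ⟨n + 1, by rw [← hdim, hn]; norm_cast, f :: rs', by simpa using hlen, hmem2, ?_⟩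
  rw [isRegular_iff_isWeaklyRegular_of_subset_maximalIdeal hmem2, isWeaklyRegular_cons_iff]
  exact ⟨hreg, (isWeaklyRegular_quotient_span_singleton_iff f rs').mp h.toIsWeaklyRegular⟩

theorem isCMLocal_of_spanFinrank_eq (d : ℕ) : ∀ (S : Type u) [CommRing S] [IsRegularLocalRing S],
    (maximalIdeal S).spanFinrank = d → IsCMLocal S := by
  induction d with
  | zero =>
    intro S _ _ h
    have h1 := (isRegularLocalRing_iff S).mp ‹_›
    exact ⟨0, by rw [← h1, h], [], by simp, by simp, .nil _ _⟩
  | succ d ih =>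
    intro S _ _ h
    have h0 : maximalIdeal S ≠ ⊥ := fun h0 ↦ by simp [h0] at h
    obtain ⟨x, hx, hx2, hxq⟩ := exists_mem_maximalIdeal_notMem_sq h0
    have := isRegularLocalRing_quotient_span_singleton hx hx2
    have h1 := spanFinrank_maximalIdeal_quotient_succ_le hx hx2
    have h2 := (isRegularLocalRing_iff S).mp ‹_›
    have h3 := (isRegularLocalRing_iff (S ⧸ Ideal.span {x})).mp ‹_›
    have h4 := ringKrullDim_le_quotient_span_singleton_succ hx
    rw [← h2, ← h3] at h4
    have h5 : (maximalIdeal S).spanFinrank ≤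
      (maximalIdeal (S ⧸ Ideal.span {x})).spanFinrank + 1 := by exact_mod_cast h4
    have hx0 : x ≠ 0 := by rintro rfl; exact hx2 (zero_mem _)
    exact isCMLocal_of_quotient hx (IsSMulRegular.of_ne_zero hx0)
      (ih (S ⧸ Ideal.span {x}) (by omega))

theorem IsRegularLocalRing.isCMLocal (S : Type u) [CommRing S] [IsRegularLocalRing S] :
    IsCMLocal S :=
  isCMLocal_of_spanFinrank_eq _ S rfl

end Depth

/-! ### Regular sequences on cokernels in 2-periodic complexes. -/

section Periodic

open Pointwise

/-- Over a ring, the cokernel of a map in a 2-periodic exact complex inherits the weakly regular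
sequences of the ambient module. -/
theorem RingTheory.Sequence.IsWeaklyRegular.of_periodic {A : Type*} [CommRing A] (rs : List A) :
    ∀ {F M : Type*} [AddCommGroup F] [Module A F] [AddCommGroup M] [Module A M]
      {φ ψ : F →ₗ[A] F} {π : F →ₗ[A] M}, Function.Exact ψ φ → Function.Exact φ ψ →
      Function.Exact φ π → Function.Surjective π → IsWeaklyRegular F rs →
      IsWeaklyRegular M rs := by
  induction rs with
  | nil => intros; exact .nil _ _
  | cons r rs ih =>
    intro F M _ _ _ _ φ ψ π hψφ hφψ hπ hsurj h
    rw [isWeaklyRegular_cons_iff] at h ⊢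
    obtain ⟨hr, h⟩ := h
    have hmk : ∀ {N : Type _} [AddCommGroup N] [Module A N] (v : N),
        (Submodule.Quotient.mk v : QuotSMulTop r N) = 0 ↔ ∃ u, r • u = v := by
      intro N _ _ v
      rw [Submodule.Quotient.mk_eq_zero, Submodule.mem_smul_pointwise_iff_exists]
      simp
    -- Exactness survives reduction modulo r. If β v = r u, then r α u = 0, so α u = 0 and u = β w.
    -- Hence v − r w comes from α.
    have key : ∀ α β : F →ₗ[A] F, Function.Exact α β → Function.Exact β α →
        Function.Exact (QuotSMulTop.map r α) (QuotSMulTop.map r β) := by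
      intro α β hαβ hβα v
      obtain ⟨v, rfl⟩ := Submodule.Quotient.mk_surjective _ v
      constructor
      · intro hv
        obtain ⟨u, hu⟩ := (hmk (β v)).mp hv
        have h1 : α u = 0 := hr (by
          simp only [← map_smul, hu, hβα.apply_apply_eq_zero, smul_zero])
        obtain ⟨w, rfl⟩ := (hβα u).mp h1
        have h2 : β (v - r • w) = 0 := by rw [map_sub, map_smul, hu, sub_self]
        obtain ⟨t, ht⟩ := (hαβ _).mp h2
        refine ⟨Submodule.Quotient.mk t, ?_⟩
        change Submodule.Quotient.mk (α t) = _
        rw [ht, Submodule.Quotient.mk_sub, (hmk (r • w)).mpr ⟨w, rfl⟩, sub_zero]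
      · rintro ⟨t, ht⟩
        obtain ⟨t, rfl⟩ := Submodule.Quotient.mk_surjective _ t
        rw [← ht]
        change Submodule.Quotient.mk (β (α t)) = _
        rw [hαβ.apply_apply_eq_zero, Submodule.Quotient.mk_zero]
    refine ⟨?_, ih (key ψ φ hψφ hφψ) (key φ ψ hφψ hψφ) (QuotSMulTop.map_exact r hπ hsurj)
      (QuotSMulTop.map_surjective r hsurj) h⟩
    -- Through ψ, M is isomorphic to a submodule of F, on which r is regular.
    rw [isSMulRegular_iff_right_eq_zero_of_smul]
    intro m hm
    obtain ⟨v, rfl⟩ := hsurj m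
    rw [← map_smul] at hm
    obtain ⟨u, hu⟩ := (hπ _).mp hm
    have h1 : ψ v = 0 := hr (by
      simp only [← map_smul, ← hu, hφψ.apply_apply_eq_zero, smul_zero])
    obtain ⟨w, rfl⟩ := (hφψ v).mp h1
    exact hπ.apply_apply_eq_zero w

end Periodic

/-! ### A criterion for a localization not to be free. -/

section NonFree

/-- A minimal surjection from a finite module onto a projective module is injective. -/
theorem ker_eq_bot_of_ker_le_maximalIdeal_smul {A : Type*} [CommRing A] [IsLocalRing A]
    {F N : Type*} [AddCommGroup F] [Module A F] [Module.Finite A F] [AddCommGroup N] [Module A N]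
    [Module.Projective A N] (q : F →ₗ[A] N) (hq : Function.Surjective q)
    (hker : LinearMap.ker q ≤ maximalIdeal A • ⊤) : LinearMap.ker q = ⊥ := by
  obtain ⟨s, hs⟩ := Module.projective_lifting_property q LinearMap.id hq
  have hs' : ∀ n, q (s n) = n := fun n ↦ by simpa using LinearMap.congr_fun hs n
  let p : F →ₗ[A] F := LinearMap.id - s.comp q
  have hp : LinearMap.range p = LinearMap.ker q := by
    ext v
    simp only [LinearMap.mem_range, LinearMap.mem_ker]
    constructor
    · rintro ⟨u, rfl⟩
      simp [p, hs']
    · intro hv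
      exact ⟨v, by simp [p, hv]⟩
  -- The splitting projects F onto the kernel, so the kernel lies in 𝔪 times itself and Nakayama
  -- applies.
  refine Submodule.eq_bot_of_le_smul_of_le_jacobson_bot (maximalIdeal A) _ ?_ ?_
    (maximalIdeal_le_jacobson _)
  · rw [← hp, LinearMap.range_eq_map]
    exact Module.Finite.fg_top.map p
  · intro v hv
    have h1 : p v = v := by simp [p, LinearMap.mem_ker.mp hv]
    rw [← h1, ← hp, LinearMap.range_eq_map, ← Submodule.map_smul'']
    exact Submodule.mem_map_of_mem (hker hv)

/-- The hypotheses say, with denominators cleared, that f is a minimal generating map at P. If the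
target is free there, a minimal surjection is injective, so every relation dies at P. -/
theorem exists_smul_eq_zero_of_free_localizedModule {R : Type*} [CommRing R] (P : Ideal R)
    [P.IsPrime] {F M : Type*} [AddCommGroup F] [Module R F] [Module.Finite R F] [AddCommGroup M]
    [Module R M] (f : F →ₗ[R] M) (hsurj : ∀ m, ∃ t ∉ P, ∃ v, f v = t • m)
    (hker : ∀ v, f v = 0 → v ∈ P • (⊤ : Submodule R F))
    (hfree : Module.Free (Localization.AtPrime P) (LocalizedModule P.primeCompl M))
    (v : F) (hv : f v = 0) : ∃ t ∉ P, t • v = 0 := by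
  let g := LocalizedModule.map P.primeCompl f
  have hg : Function.Surjective g := by
    intro x
    induction x using LocalizedModule.induction_on with
    | h m s =>
      obtain ⟨t, ht, v, hv⟩ := hsurj m
      refine ⟨LocalizedModule.mk v (⟨t, ht⟩ * s), ?_⟩
      rw [LocalizedModule.map_mk, hv]
      exact LocalizedModule.mk_cancel_common_left ⟨t, ht⟩ s m
  have : Module.Finite (Localization.AtPrime P) (LocalizedModule P.primeCompl F) :=
    Module.Finite.of_isLocalizedModule P.primeCompl (LocalizedModule.mkLinearMap P.primeCompl F)
  have hgker : LinearMap.ker g = ⊥ := by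
    refine ker_eq_bot_of_ker_le_maximalIdeal_smul g hg fun x hx ↦ ?_
    rw [LinearMap.mem_ker] at hx
    induction x using LocalizedModule.induction_on with
    | h w s =>
      rw [LocalizedModule.map_mk, ← LocalizedModule.zero_mk s, LocalizedModule.mk_eq] at hx
      obtain ⟨u, hu⟩ := hx
      have h1 : f ((u.1 * s.1) • w) = 0 := by
        rw [map_smul, mul_smul]
        simpa [Submonoid.smul_def] using hu
      have h2 := hker _ h1
      have h3 : ∀ z ∈ P • (⊤ : Submodule R F), ∀ s, LocalizedModule.mk z s ∈
          maximalIdeal (Localization.AtPrime P) •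
            (⊤ : Submodule (Localization.AtPrime P) (LocalizedModule P.primeCompl F)) := by
        intro z hz s
        induction hz using Submodule.smul_induction_on' with
        | smul a ha n hn =>
          have : LocalizedModule.mk (a • n) s =
              (Localization.mk a 1 : Localization.AtPrime P) • LocalizedModule.mk n s := by
            rw [LocalizedModule.mk_smul_mk, one_mul]
          rw [this]
          refine Submodule.smul_mem_smul ?_ trivial
          rw [Localization.mk_one_eq_algebraMap]
          exact (IsLocalization.AtPrime.to_map_mem_maximal_iff _ P a).mpr ha
        | add a ha b hb h1 h2 =>
          rw [show LocalizedModule.mk (a + b) s = LocalizedModule.mk a s + LocalizedModule.mk b s by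
            rw [LocalizedModule.mk_add_mk, ← smul_add, LocalizedModule.mk_cancel_common_left]]
          exact add_mem h1 h2
      have h4 : LocalizedModule.mk w s = LocalizedModule.mk ((u.1 * s.1) • w) ((u * s) * s) :=
        (LocalizedModule.mk_cancel_common_left (u * s) s w).symm
      rw [h4]
      exact h3 _ h2 _
  have h1 : (LocalizedModule.mk v 1 : LocalizedModule P.primeCompl F) ∈ LinearMap.ker g := by
    rw [LinearMap.mem_ker, LocalizedModule.map_mk, hv, LocalizedModule.zero_mk]
  rw [hgker, Submodule.mem_bot, ← LocalizedModule.zero_mk 1, LocalizedModule.mk_eq] at h1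
  obtain ⟨u, hu⟩ := h1
  exact ⟨u, u.2, by simpa [Submonoid.smul_def] using hu⟩

end NonFree

/-! ### Cokernels of matrix factorizations. -/

section MatrixCoker

open scoped Matrix

variable {S : Type u} [CommRing S] {n : ℕ}

/-- The cokernel over `S ⧸ (f)` of a square matrix over `S`. -/
abbrev MatrixCoker (f : S) (φ : Matrix (Fin n) (Fin n) S) : Type u :=
  (Fin n → S ⧸ Ideal.span {f}) ⧸
    LinearMap.range (φ.map (Ideal.Quotient.mk (Ideal.span {f}))).mulVecLin

namespace MatrixCoker

/-- The projection of `Sⁿ` to the cokernel. -/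
noncomputable def proj (f : S) (φ : Matrix (Fin n) (Fin n) S) :
    (Fin n → S) →ₗ[S] MatrixCoker f φ :=
  ((Submodule.mkQ _).restrictScalars S).comp
    ((Submodule.mkQ (Ideal.span {f})).compLeft (Fin n))

theorem proj_apply (f : S) (φ : Matrix (Fin n) (Fin n) S) (v : Fin n → S) :
    proj f φ v = Submodule.Quotient.mk (fun i ↦ Ideal.Quotient.mk (Ideal.span {f}) (v i)) :=
  rfl

theorem proj_surjective (f : S) (φ : Matrix (Fin n) (Fin n) S) :
    Function.Surjective (proj f φ) := by
  intro m
  obtain ⟨v, rfl⟩ := Submodule.Quotient.mk_surjective _ m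
  choose w hw using fun i ↦ Ideal.Quotient.mk_surjective (v i)
  refine ⟨w, ?_⟩
  rw [proj_apply]
  exact congrArg _ (funext hw)

theorem mk_mulVec {I : Ideal S} {m : ℕ} (φ : Matrix (Fin m) (Fin n) S) (u : Fin n → S) :
    φ.map (Ideal.Quotient.mk I) *ᵥ (fun i ↦ Ideal.Quotient.mk I (u i)) =
      fun i ↦ Ideal.Quotient.mk I ((φ *ᵥ u) i) := by
  ext i
  simp [Matrix.mulVec, dotProduct]

/-- Since φψ = f, multiples of f already lie in the image of φ over S, so passing to the quotient
ring adds no relations. -/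
theorem proj_eq_zero_iff {f : S} {φ ψ : Matrix (Fin n) (Fin n) S} (h : φ * ψ = f • 1)
    (v : Fin n → S) : proj f φ v = 0 ↔ ∃ u, φ *ᵥ u = v := by
  rw [proj_apply, Submodule.Quotient.mk_eq_zero, LinearMap.mem_range]
  constructor
  · rintro ⟨u, hu⟩
    choose w hw using fun i ↦ Ideal.Quotient.mk_surjective (u i)
    obtain rfl : (fun i ↦ Ideal.Quotient.mk (Ideal.span {f}) (w i)) = u := funext hw
    rw [Matrix.mulVecLin_apply, mk_mulVec] at hu
    have h1 : ∀ i, ∃ c, v i = (φ *ᵥ w) i + f * c := by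
      intro i
      have h2 := congrFun hu i
      rw [eq_comm, Ideal.Quotient.eq, Ideal.mem_span_singleton] at h2
      obtain ⟨c, hc⟩ := h2
      exact ⟨c, by rw [← hc]; ring⟩
    choose c hc using h1
    refine ⟨w + ψ *ᵥ c, ?_⟩
    rw [Matrix.mulVec_add, Matrix.mulVec_mulVec, h]
    ext i
    simp [hc, Matrix.smul_mulVec]
  · rintro ⟨u, rfl⟩
    exact ⟨fun i ↦ Ideal.Quotient.mk _ (u i), mk_mulVec φ u⟩

/-- Homomorphisms between cokernels of matrix factorizations lift to the matrices. -/
theorem exists_matrix_of_linearMap {f : S} {φ φ' ψ ψ' : Matrix (Fin n) (Fin n) S}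
    (hφ : φ * ψ = f • 1) (hφ' : φ' * ψ' = f • 1)
    (h : MatrixCoker f φ →ₗ[S ⧸ Ideal.span {f}] MatrixCoker f φ') :
    ∃ P Q : Matrix (Fin n) (Fin n) S, P * φ = φ' * Q ∧
      ∀ v, h (proj f φ v) = proj f φ' (P *ᵥ v) := by
  obtain ⟨p, hp⟩ := Module.projective_lifting_property (proj f φ')
    ((h.restrictScalars S).comp (proj f φ)) (proj_surjective f φ')
  have hp' : ∀ v, h (proj f φ v) = proj f φ' (LinearMap.toMatrix' p *ᵥ v) := fun v ↦ by
    rw [LinearMap.toMatrix'_mulVec]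
    exact (LinearMap.congr_fun hp v).symm
  have hQ : ∀ u, ∃ w, φ' *ᵥ w = LinearMap.toMatrix' p *ᵥ (φ *ᵥ u) := fun u ↦ by
    rw [← proj_eq_zero_iff hφ', ← hp', (proj_eq_zero_iff hφ _).mpr ⟨u, rfl⟩, map_zero]
  choose w hw using hQ
  refine ⟨LinearMap.toMatrix' p, Matrix.of fun i j ↦ w (Pi.single j 1) i, ?_, hp'⟩
  ext i j
  have h1 := congrFun (hw (Pi.single j 1)) i
  rw [Matrix.mulVec_mulVec, Matrix.mulVec_single_one] at h1
  simpa [Matrix.mul_apply, Matrix.mulVec, dotProduct] using h1.symm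

theorem surjective_of_isUnit_det {f : S} {φ : Matrix (Fin n) (Fin n) S}
    {h : MatrixCoker f φ →ₗ[S ⧸ Ideal.span {f}] MatrixCoker f φ} {P : Matrix (Fin n) (Fin n) S}
    (hP : ∀ v, h (proj f φ v) = proj f φ (P *ᵥ v)) (hdet : IsUnit P.det) :
    Function.Surjective h := by
  intro m
  obtain ⟨v, rfl⟩ := proj_surjective f φ m
  refine ⟨proj f φ (P⁻¹ *ᵥ v), ?_⟩
  rw [hP, Matrix.mulVec_mulVec, Matrix.mul_nonsing_inv _ hdet, Matrix.one_mulVec]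

/-- The projection onto a summand lifts to a matrix P. If P or 1 − P is invertible, the projection
or its complement is surjective, so one summand is everything. -/
theorem isIndecomposableModule {f : S} {φ ψ : Matrix (Fin n) (Fin n) S}
    (hφ : φ * ψ = f • 1) (hnt : Nontrivial (MatrixCoker f φ))
    (hdet : ∀ P Q : Matrix (Fin n) (Fin n) S, P * φ = φ * Q → IsUnit P.det ∨ IsUnit (1 - P).det) :
    IsIndecomposableModule (S ⧸ Ideal.span {f}) (MatrixCoker f φ) := by
  refine ⟨hnt, fun N N' hN ↦ ?_⟩
  let e := N.projection N' hN
  obtain ⟨P, Q, hPQ, hP⟩ := exists_matrix_of_linearMap hφ hφ e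
  rcases hdet P Q hPQ with hd | hd
  · right
    have hs := surjective_of_isUnit_det hP hd
    have hN' : N = ⊤ := by
      rw [eq_top_iff]
      intro m _
      obtain ⟨m, rfl⟩ := hs m
      exact Submodule.projection_apply_mem hN m
    rw [← inf_top_eq N', ← hN', inf_comm]
    exact hN.inf_eq_bot
  · left
    have hs : Function.Surjective ((LinearMap.id : MatrixCoker f φ →ₗ[S ⧸ Ideal.span {f}] _) - e) := by
      refine surjective_of_isUnit_det (P := 1 - P) (fun v ↦ ?_) hd
      rw [Matrix.sub_mulVec, Matrix.one_mulVec, map_sub, ← hP]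
      rfl
    have hN' : N' = ⊤ := by
      rw [eq_top_iff]
      intro m _
      obtain ⟨m, rfl⟩ := hs m
      exact Submodule.sub_projection_mem hN m
    rw [← inf_top_eq N, ← hN']
    exact hN.inf_eq_bot

theorem mulVec_apply_mem {m : ℕ} {A : Matrix (Fin m) (Fin n) S} {J : Ideal S}
    (hA : ∀ i j, A i j ∈ J) (v : Fin n → S) (i : Fin m) : (A *ᵥ v) i ∈ J := by
  rw [Matrix.mulVec, dotProduct]
  exact Ideal.sum_mem _ fun j _ ↦ Ideal.mul_mem_right _ _ (hA i j)

theorem mul_apply_mem_left {A B : Matrix (Fin n) (Fin n) S} {J : Ideal S}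
    (hA : ∀ i j, A i j ∈ J) (i j : Fin n) : (A * B) i j ∈ J := by
  rw [Matrix.mul_apply]
  exact Ideal.sum_mem _ fun k _ ↦ Ideal.mul_mem_right _ _ (hA i k)

theorem mul_apply_mem_right {A B : Matrix (Fin n) (Fin n) S} {J : Ideal S}
    (hB : ∀ i j, B i j ∈ J) (i j : Fin n) : (A * B) i j ∈ J := by
  rw [Matrix.mul_apply]
  exact Ideal.sum_mem _ fun k _ ↦ Ideal.mul_mem_left _ _ (hB k j)

theorem nontrivial [IsLocalRing S] {f : S} {φ ψ : Matrix (Fin n) (Fin n) S}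
    (hφ : φ * ψ = f • 1) (hm : ∀ i j, φ i j ∈ maximalIdeal S) (i : Fin n) :
    Nontrivial (MatrixCoker f φ) := by
  refine ⟨proj f φ (Pi.single i 1), 0, fun h ↦ ?_⟩
  obtain ⟨u, hu⟩ := (proj_eq_zero_iff hφ _).mp h
  have h1 := congrFun hu i
  rw [Pi.single_eq_same] at h1
  have h2 : (1 : S) ∈ maximalIdeal S := by
    rw [← h1]
    exact mulVec_apply_mem hm u i
  exact (maximalIdeal.isMaximal S).ne_top ((Ideal.eq_top_iff_one _).mpr h2)

/-- The ideal of entries of a reduced matrix factorization is an invariant of its cokernel. -/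
theorem mem_of_linearEquiv [IsLocalRing S] {f : S}
    {φ φ' ψ ψ' : Matrix (Fin n) (Fin n) S} (hφ : φ * ψ = f • 1) (hφ' : φ' * ψ' = f • 1)
    (hm : ∀ i j, φ i j ∈ maximalIdeal S)
    (e : MatrixCoker f φ ≃ₗ[S ⧸ Ideal.span {f}] MatrixCoker f φ') {J : Ideal S}
    (hJ : ∀ i j, φ' i j ∈ J) (i j : Fin n) : φ i j ∈ J := by
  obtain ⟨P, Q, hPQ, hP⟩ := exists_matrix_of_linearMap hφ hφ' e.toLinearMap
  obtain ⟨P', Q', hPQ', hP'⟩ := exists_matrix_of_linearMap hφ' hφ e.symm.toLinearMap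
  have h1 : ∀ v, ∃ u, φ *ᵥ u = (P' * P - 1) *ᵥ v := fun v ↦ by
    rw [← proj_eq_zero_iff hφ, Matrix.sub_mulVec, ← Matrix.mulVec_mulVec, map_sub, ← hP', ← hP]
    simp
  -- Since P'P lifts the identity, the columns of P'P − 1 lie in the image of φ, hence in 𝔪. So P'P
  -- is invertible and φ = (P'P)⁻¹P'φ'Q.
  have h2 : ∀ i j, (P' * P - 1) i j ∈ maximalIdeal S := by
    intro i j
    obtain ⟨u, hu⟩ := h1 (Pi.single j 1)
    rw [Matrix.mulVec_single_one] at hu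
    have := congrFun hu i
    rw [Matrix.col_apply] at this
    rw [← this]
    exact mulVec_apply_mem hm u i
  have hdet : IsUnit (P' * P).det := by
    have h3 : (residue S).mapMatrix (P' * P) = 1 := by
      rw [← sub_eq_zero, ← map_one (residue S).mapMatrix, ← map_sub]
      ext i j
      simpa using (residue_eq_zero_iff _).mpr (h2 i j)
    have h4 := RingHom.map_det (residue S) (P' * P)
    rw [h3, Matrix.det_one] at h4
    by_contra h5
    rw [(residue_eq_zero_iff _).mpr ((mem_maximalIdeal _).mpr h5)] at h4
    exact zero_ne_one h4
  have h3 : φ = (P' * P)⁻¹ * (P' * (φ' * Q)) := by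
    rw [← hPQ, ← Matrix.mul_assoc P', ← Matrix.mul_assoc, Matrix.nonsing_inv_mul _ hdet,
      Matrix.one_mul]
  rw [h3]
  exact mul_apply_mem_right (mul_apply_mem_right (mul_apply_mem_left hJ)) i j

/-- If φw = fc, then fw = ψφw = fψc, and f cancels in the domain S. -/
theorem exact_mulVecLin [IsDomain S] {f : S} (hf : f ≠ 0) {φ ψ : Matrix (Fin n) (Fin n) S}
    (h : φ * ψ = f • 1) (h' : ψ * φ = f • 1) :
    Function.Exact (ψ.map (Ideal.Quotient.mk (Ideal.span {f}))).mulVecLin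
      (φ.map (Ideal.Quotient.mk (Ideal.span {f}))).mulVecLin := by
  intro v
  choose w hw using fun i ↦ Ideal.Quotient.mk_surjective (v i)
  obtain rfl : (fun i ↦ Ideal.Quotient.mk (Ideal.span {f}) (w i)) = v := funext hw
  rw [Matrix.mulVecLin_apply, mk_mulVec]
  constructor
  · intro hv
    have h1 : ∀ i, ∃ c, (φ *ᵥ w) i = f * c := fun i ↦ by
      have h2 := congrFun hv i
      rwa [Pi.zero_apply, Ideal.Quotient.eq_zero_iff_mem, Ideal.mem_span_singleton] at h2
    choose c hc using h1
    have h2 : φ *ᵥ w = f • c := funext hc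
    have h3 : f • w = f • (ψ *ᵥ c) := by
      calc f • w = (ψ * φ) *ᵥ w := by rw [h', Matrix.smul_mulVec, Matrix.one_mulVec]
        _ = _ := by rw [← Matrix.mulVec_mulVec, h2, Matrix.mulVec_smul]
    have h4 : w = ψ *ᵥ c := funext fun i ↦ mul_left_cancel₀ hf (congrFun h3 i)
    exact ⟨fun i ↦ Ideal.Quotient.mk _ (c i), by rw [Matrix.mulVecLin_apply, mk_mulVec, h4]⟩
  · rintro ⟨u, hu⟩
    choose t ht using fun i ↦ Ideal.Quotient.mk_surjective (u i)
    obtain rfl : (fun i ↦ Ideal.Quotient.mk (Ideal.span {f}) (t i)) = u := funext ht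
    rw [← mk_mulVec, ← hu, Matrix.mulVecLin_apply, mk_mulVec, mk_mulVec, Matrix.mulVec_mulVec, h]
    ext i
    simp [Matrix.smul_mulVec, Ideal.Quotient.eq_zero_iff_mem.mpr (Ideal.mem_span_singleton_self f)]

theorem isMaximalCM [IsDomain S] [IsNoetherianRing S] {f : S} (hf : f ≠ 0)
    [IsLocalRing (S ⧸ Ideal.span {f})] (hCM : IsCMLocal (S ⧸ Ideal.span {f}))
    {φ ψ : Matrix (Fin n) (Fin n) S} (h : φ * ψ = f • 1) (h' : ψ * φ = f • 1) :
    IsMaximalCM (S ⧸ Ideal.span {f}) (MatrixCoker f φ) := by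
  refine ⟨inferInstance, fun p hp ↦ ?_⟩
  rw [IsLocalization.AtPrime.ringKrullDim_eq_height p]
  obtain ⟨k, hk⟩ := ENat.ne_top_iff_exists.mp (Ideal.height_ne_top (I := p) hp.ne_top)
  -- A weakly regular sequence in p of length ht p passes from the ring to a free module, then to
  -- the cokernel, then to its localization.
  obtain ⟨rs, hlen, hmem, hreg⟩ := hCM.exists_isWeaklyRegular k p hk.le
  have hF : IsWeaklyRegular (Fin n → S ⧸ Ideal.span {f}) rs :=
    ((TensorProduct.rid _ (Fin n → S ⧸ Ideal.span {f})).isWeaklyRegular_congr rs).mp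
      hreg.isWeaklyRegular_lTensor
  have hM : IsWeaklyRegular (MatrixCoker f φ) rs :=
    IsWeaklyRegular.of_periodic rs (exact_mulVecLin hf h h') (exact_mulVecLin hf h' h)
      (LinearMap.exact_map_mkQ_range _) (Submodule.mkQ_surjective _) hF
  have hL := IsWeaklyRegular.of_isLocalizedModule (Localization.AtPrime p) p.primeCompl
    (LocalizedModule.mkLinearMap p.primeCompl (MatrixCoker f φ)) hM
  norm_cast
  rw [← hk, ← hlen, ← List.length_map (algebraMap _ (Localization.AtPrime p))]
  refine le_iSup₂_of_le (f := fun (rs : List (Localization.AtPrime p))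
    (_ : (∀ r ∈ rs, r ∈ maximalIdeal (Localization.AtPrime p)) ∧
      IsWeaklyRegular (LocalizedModule p.primeCompl (MatrixCoker f φ)) rs) ↦ (rs.length : ℕ∞))
    _ ⟨?_, hL⟩ le_rfl
  intro r hr
  obtain ⟨a, ha, rfl⟩ := List.mem_map.mp hr
  exact (IsLocalization.AtPrime.to_map_mem_maximal_iff _ p a).mpr (hmem a ha)

end MatrixCoker

end MatrixCoker

/-! ### The two infinite families. -/

section Families

open scoped Matrix

variable {S : Type u} [CommRing S]

/-- The columns of E minimally generate the cokernel at P, because all relations among them have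
coefficients in P. The relation u does not vanish at P over S/(f), which freeness would demand. -/
theorem not_isLocallyFreeOnPunctured_matrixCoker [IsLocalRing S] {n k : ℕ} {f : S}
    {φ ψ : Matrix (Fin n) (Fin n) S} (hφ : φ * ψ = f • 1) {P : Ideal S} [P.IsPrime]
    (hP : P ≠ maximalIdeal S) (hfP : f ∈ P) (E : Matrix (Fin n) (Fin k) S)
    (hsurj : ∀ v : Fin n → S, ∃ t ∉ P, ∃ u w, E *ᵥ u + φ *ᵥ w = t • v)
    (hker : ∀ u w, E *ᵥ u = φ *ᵥ w → ∀ i, u i ∈ P) {u : Fin k → S} {w : Fin n → S}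
    (huw : E *ᵥ u = φ *ᵥ w) (i : Fin k) (hne : ∀ t ∉ P, ¬ f ∣ t * u i) :
    ¬ IsLocallyFreeOnPunctured (S ⧸ Ideal.span {f}) (MatrixCoker f φ) := by
  intro hfree
  let π := Ideal.Quotient.mk (Ideal.span {f})
  have hle : Ideal.span {f} ≤ P := by simpa [Ideal.span_singleton_le_iff_mem] using hfP
  have hmem : ∀ s, π s ∈ P.map π ↔ s ∈ P := fun s ↦ by
    rw [Ideal.mem_quotient_iff_mem hle]
  have hPp : (P.map π).IsPrime := Ideal.isPrime_map_quotientMk_of_isPrime hle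
  have hPm : ¬ (P.map π).IsMaximal := fun h ↦ by
    have h1 := Ideal.comap_isMaximal_of_surjective π Ideal.Quotient.mk_surjective (K := P.map π)
    have h2 : (P.map π).comap π = P := by ext s; rw [Ideal.mem_comap, hmem]
    rw [h2] at h1
    exact hP (eq_maximalIdeal h1)
  let F : (Fin k → S ⧸ Ideal.span {f}) →ₗ[S ⧸ Ideal.span {f}] MatrixCoker f φ :=
    (Submodule.mkQ _).comp (E.map π).mulVecLin
  have hF : ∀ u : Fin k → S, F (fun i ↦ π (u i)) = MatrixCoker.proj f φ (E *ᵥ u) := fun u ↦ by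
    rw [MatrixCoker.proj_apply, ← MatrixCoker.mk_mulVec]
    rfl
  have hFsurj : ∀ m, ∃ t ∉ P.map π, ∃ v, F v = t • m := by
    intro m
    obtain ⟨v, rfl⟩ := MatrixCoker.proj_surjective f φ m
    obtain ⟨t, ht, u, w, huw⟩ := hsurj v
    refine ⟨π t, fun h ↦ ht ((hmem t).mp h), fun i ↦ π (u i), ?_⟩
    have h1 : MatrixCoker.proj f φ (φ *ᵥ w) = 0 :=
      (MatrixCoker.proj_eq_zero_iff hφ _).mpr ⟨w, rfl⟩
    rw [hF, ← add_zero (MatrixCoker.proj f φ (E *ᵥ u)), ← h1, ← map_add, huw, map_smul]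
    rfl
  have hFker : ∀ v, F v = 0 → v ∈ P.map π • (⊤ : Submodule (S ⧸ Ideal.span {f}) _) := by
    intro v hv
    choose u hu using fun i ↦ Ideal.Quotient.mk_surjective (v i)
    obtain rfl : (fun i ↦ π (u i)) = v := funext hu
    rw [hF, MatrixCoker.proj_eq_zero_iff hφ] at hv
    obtain ⟨w, hw⟩ := hv
    have h1 := hker u w hw.symm
    rw [pi_eq_sum_univ (fun i ↦ π (u i))]
    exact Submodule.sum_mem _ fun i _ ↦
      Submodule.smul_mem_smul ((hmem _).mpr (h1 i)) trivial
  obtain ⟨t, ht, htu⟩ := exists_smul_eq_zero_of_free_localizedModule (P.map π) F hFsurj hFker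
    (hfree _ hPm) (fun i ↦ π (u i))
    (by rw [hF]; exact (MatrixCoker.proj_eq_zero_iff hφ _).mpr ⟨w, huw.symm⟩)
  obtain ⟨t, rfl⟩ := Ideal.Quotient.mk_surjective t
  have h1 := congrFun htu i
  rw [Pi.smul_apply, Pi.zero_apply, smul_eq_mul, ← map_mul, Ideal.Quotient.eq_zero_iff_mem,
    Ideal.mem_span_singleton] at h1
  exact hne t (fun h ↦ ht ((hmem t).mpr h)) h1

theorem hasInfiniteCMPlusType_of_matrix_family [IsRegularLocalRing S] {f : S} (hf : f ≠ 0)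
    (hfm : f ∈ maximalIdeal S) {n : ℕ} (i₀ : Fin n) (φ ψ : ℕ → Matrix (Fin n) (Fin n) S)
    (h : ∀ k, φ k * ψ k = f • 1) (h' : ∀ k, ψ k * φ k = f • 1)
    (hm : ∀ k i j, φ k i j ∈ maximalIdeal S)
    (hdet : ∀ k, ∀ P Q : Matrix (Fin n) (Fin n) S, P * φ k = φ k * Q →
      IsUnit P.det ∨ IsUnit (1 - P).det)
    (hfree : ∀ k, ¬ IsLocallyFreeOnPunctured (S ⧸ Ideal.span {f}) (MatrixCoker f (φ k)))
    (hdist : ∀ k l, k < l → ∃ J : Ideal S, (∀ i j, φ l i j ∈ J) ∧ ∃ i j, φ k i j ∉ J) :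
    HasInfiniteCMPlusType (S ⧸ Ideal.span {f}) := by
  have := isLocalRing_quotient_span_singleton hfm
  have hCM : IsCMLocal (S ⧸ Ideal.span {f}) :=
    (IsRegularLocalRing.isCMLocal S).quotient_span_singleton hfm (IsSMulRegular.of_ne_zero hf)
  let c : ℕ → Quotient (isIsomorphicSetoid (ModuleCat.{u} (S ⧸ Ideal.span {f}))) :=
    fun k ↦ Quotient.mk _ (ModuleCat.of _ (MatrixCoker f (φ k)))
  refine Set.infinite_of_injective_forall_mem (f := c) ?_ ?_
  · have key : ∀ k l, k < l → c k ≠ c l := by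
      intro k l hkl hc
      obtain ⟨J, hJ, i, j, hij⟩ := hdist k l hkl
      obtain ⟨e⟩ := Quotient.exact hc
      exact hij (MatrixCoker.mem_of_linearEquiv (h k) (h l) (hm k) e.toLinearEquiv hJ i j)
    intro k l hkl
    by_contra hne
    rcases lt_or_gt_of_ne hne with hlt | hlt
    · exact key k l hlt hkl
    · exact key l k hlt hkl.symm
  · intro k
    exact ⟨_, MatrixCoker.isIndecomposableModule (h k) (MatrixCoker.nontrivial (h k) (hm k) i₀)
      (hdet k), ⟨MatrixCoker.isMaximalCM hf hCM (h k) (h' k), hfree k⟩, rfl⟩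

/-- Modulo 𝔪 the matrix is triangular with a single eigenvalue λ, and λ and 1 − λ are not both zero.
The 3 × 3 version is the same after reordering the basis. -/
theorem isUnit_det_or_fin_two [IsLocalRing S] (P : Matrix (Fin 2) (Fin 2) S)
    (h10 : P 1 0 ∈ maximalIdeal S) (h01 : P 0 0 - P 1 1 ∈ maximalIdeal S) :
    IsUnit P.det ∨ IsUnit (1 - P).det := by
  rw [← residue_ne_zero_iff_isUnit, ← residue_ne_zero_iff_isUnit, Matrix.det_fin_two,
    Matrix.det_fin_two]
  rw [← residue_eq_zero_iff] at h10 h01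
  rw [map_sub, sub_eq_zero] at h01
  simp only [Matrix.sub_apply, Matrix.one_apply_eq, map_sub, map_mul, h10, ← h01, map_one, mul_zero,
    Matrix.one_apply_ne (show (1 : Fin 2) ≠ 0 by decide), map_zero, sub_zero]
  by_cases h : residue S (P 0 0) = 0 <;> simp [h]

theorem isUnit_det_or_fin_three [IsLocalRing S] (P : Matrix (Fin 3) (Fin 3) S)
    (h10 : P 1 0 ∈ maximalIdeal S) (h20 : P 2 0 ∈ maximalIdeal S)
    (h12 : P 1 2 ∈ maximalIdeal S)
    (h1 : P 0 0 - P 1 1 ∈ maximalIdeal S) (h2 : P 0 0 - P 2 2 ∈ maximalIdeal S) :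
    IsUnit P.det ∨ IsUnit (1 - P).det := by
  rw [← residue_ne_zero_iff_isUnit, ← residue_ne_zero_iff_isUnit, Matrix.det_fin_three,
    Matrix.det_fin_three]
  rw [← residue_eq_zero_iff] at h10 h20 h12 h1 h2
  rw [map_sub, sub_eq_zero] at h1 h2
  simp only [Matrix.sub_apply, Matrix.one_apply_eq, map_sub, map_add, map_mul, h10, h20, h12, ← h1,
    ← h2, map_one, mul_zero, zero_mul, Matrix.one_apply_ne (show (1 : Fin 3) ≠ 0 by decide),
    Matrix.one_apply_ne (show (2 : Fin 3) ≠ 0 by decide),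
    Matrix.one_apply_ne (show (1 : Fin 3) ≠ 2 by decide), map_zero, sub_zero, add_zero]
  by_cases h : residue S (P 0 0) = 0 <;> simp [h]

theorem isUnit_one_sub_mul_pow [IsLocalRing S] {w : S} (hw : w ∈ maximalIdeal S) (c : S) {e : ℕ}
    (he : e ≠ 0) : IsUnit (1 - c * w ^ e) := by
  by_contra h
  have h1 : c * w ^ e ∈ maximalIdeal S :=
    Ideal.mul_mem_left _ _ (Ideal.pow_mem_of_mem _ hw _ (Nat.pos_of_ne_zero he))
  have h2 := add_mem ((mem_maximalIdeal _).mpr h) h1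
  rw [sub_add_cancel] at h2
  exact (maximalIdeal.isMaximal S).ne_top ((Ideal.eq_top_iff_one _).mpr h2)

theorem mem_of_isUnit_mul_mem {I : Ideal S} {u a : S} (hu : IsUnit u) (h : a * u ∈ I) : a ∈ I :=
  (Ideal.mul_unit_mem_iff_mem I hu).mp h

/-- The upper triangular family of `2 × 2` matrix factorizations of `x * y`. -/
theorem hasInfiniteCMPlusType_of_two_by_two [IsRegularLocalRing S] {x y : S} (hxy : x * y ≠ 0)
    {P : Ideal S} [P.IsPrime] (hP : P ≠ maximalIdeal S) (hx : x ∈ P) (hy : y ∈ P) {z w : S}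
    (hz : z ∈ P) (hw : w ∈ maximalIdeal S) (hzw : ∀ k, z * w ^ k ∉ Ideal.span {x, y}) :
    HasInfiniteCMPlusType (S ⧸ Ideal.span {x * y}) := by
  have hPm : P ≤ maximalIdeal S := le_maximalIdeal (Ideal.IsPrime.ne_top ‹_›)
  have hx0 : x ≠ 0 := left_ne_zero_of_mul hxy
  have hy0 : y ≠ 0 := right_ne_zero_of_mul hxy
  -- The shift by N keeps z·w^(N+k) from dividing y, which is needed to compare the two diagonal
  -- entries of an endomorphism.
  obtain ⟨N, hN⟩ : ∃ N, y ∉ maximalIdeal S ^ N := by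
    by_contra! h
    have h1 := Ideal.iInf_pow_eq_bot_of_isLocalRing (maximalIdeal S)
      (maximalIdeal.isMaximal S).ne_top
    have h2 : y ∈ (⨅ i : ℕ, maximalIdeal S ^ i) := by simpa [Submodule.mem_iInf] using h
    rw [h1] at h2
    exact hy0 h2
  let Z : ℕ → S := fun k ↦ z * w ^ (N + k)
  have hZP : ∀ k, Z k ∈ P := fun k ↦ Ideal.mul_mem_right _ _ hz
  have hZy : ∀ k, ¬ Z k ∣ y := fun k ⟨c, hc⟩ ↦ hN (by
    rw [hc]
    refine Ideal.mul_mem_right _ _ (Ideal.mul_mem_left _ _ ?_)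
    exact Ideal.pow_le_pow_right (Nat.le_add_right N k) (Ideal.pow_mem_pow hw _))
  have hφψ : ∀ k, !![x, Z k; 0, y] * !![y, -Z k; 0, x] = (x * y) • (1 : Matrix (Fin 2) (Fin 2) S) :=
    fun k ↦ by ext i j; fin_cases i <;> fin_cases j <;> simp [Matrix.mul_apply] <;> ring
  have hψφ : ∀ k, !![y, -Z k; 0, x] * !![x, Z k; 0, y] = (x * y) • (1 : Matrix (Fin 2) (Fin 2) S) :=
    fun k ↦ by ext i j; fin_cases i <;> fin_cases j <;> simp [Matrix.mul_apply] <;> ring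
  have hmemP : ∀ k i j, !![x, Z k; 0, y] i j ∈ P := by
    intro k i j
    fin_cases i <;> fin_cases j <;> simp [hx, hy, hZP k]
  refine hasInfiniteCMPlusType_of_matrix_family hxy (hPm (Ideal.mul_mem_right _ _ hx)) (0 : Fin 2)
    (fun k ↦ !![x, Z k; 0, y]) (fun k ↦ !![y, -Z k; 0, x]) hφψ hψφ
    (fun k i j ↦ hPm (hmemP k i j)) ?_ ?_ ?_
  · intro k A Q hAQ
    have h01 := congrFun (congrFun hAQ 0) 1
    have h11 := congrFun (congrFun hAQ 1) 1
    simp [Matrix.mul_apply, Fin.sum_univ_two] at h01 h11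
    have h1 : A 0 0 - Q 1 1 ∈ maximalIdeal S := by
      by_contra h
      rw [mem_maximalIdeal, mem_nonunits_iff, not_not] at h
      refine hzw (N + k) (mem_of_isUnit_mul_mem h ?_)
      rw [Ideal.mem_span_pair]
      exact ⟨Q 0 1, -A 0 1, by simp only [Z] at h01; linear_combination -h01⟩
    have h2 : A 1 0 ∈ maximalIdeal S := by
      by_contra h
      rw [mem_maximalIdeal, mem_nonunits_iff, not_not] at h
      refine hzw (N + k) (mem_of_isUnit_mul_mem h ?_)
      rw [Ideal.mem_span_pair]
      exact ⟨0, Q 1 1 - A 1 1, by simp only [Z] at h11; linear_combination -h11⟩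
    have h3 : Q 1 1 - A 1 1 ∈ maximalIdeal S := by
      by_contra h
      rw [mem_maximalIdeal, mem_nonunits_iff, not_not] at h
      refine hZy k (Ideal.mem_span_singleton.mp (mem_of_isUnit_mul_mem h ?_))
      rw [Ideal.mem_span_singleton]
      exact ⟨A 1 0, by linear_combination -h11⟩
    exact isUnit_det_or_fin_two A h2 (by simpa using add_mem h1 h3)
  · intro k
    -- All entries lie in P, so the standard basis is already minimal at P. The first column (x, 0)
    -- is a surviving relation: tx ∈ (xy) would give t ∈ (y) ⊆ P.
    refine not_isLocallyFreeOnPunctured_matrixCoker (hφψ k) hP (Ideal.mul_mem_right _ _ hx) 1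
      (fun v ↦ ⟨1, fun h ↦ Ideal.IsPrime.ne_top ‹_› ((Ideal.eq_top_iff_one _).mpr h), v, 0, by simp⟩)
      (fun u v huv i ↦ ?_) (u := ![x, 0]) (w := ![1, 0]) (by ext i; fin_cases i <;> simp) 0 ?_
    · rw [Matrix.one_mulVec] at huv
      rw [huv]
      exact MatrixCoker.mulVec_apply_mem (hmemP k) _ _
    · rintro t ht ⟨c, hc⟩
      apply ht
      have h1 : t = y * c := mul_left_cancel₀ hx0 (by simp at hc; linear_combination hc)
      rw [h1]
      exact Ideal.mul_mem_right _ _ hy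
  · intro k l hkl
    refine ⟨Ideal.span {x, y, Z l}, fun i j ↦ ?_, 0, 1, fun h ↦ ?_⟩
    · fin_cases i <;> fin_cases j <;>
        first | exact zero_mem _ | exact Ideal.subset_span (by simp)
    · simp only [Matrix.of_apply, Matrix.cons_val_zero, Matrix.cons_val_one] at h
      obtain ⟨α, q, hq, h⟩ := Ideal.mem_span_insert.mp h
      obtain ⟨β, γ, rfl⟩ := Ideal.mem_span_pair.mp hq
      obtain ⟨e, rfl⟩ : ∃ e, l = k + (e + 1) := ⟨l - k - 1, by omega⟩
      -- Membership of the k-th corner entry in the l-th entry ideal puts that entry times the unit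
      -- 1 − γ·w^(e+1) into (x, y).
      refine hzw (N + k) (mem_of_isUnit_mul_mem (isUnit_one_sub_mul_pow hw γ (Nat.add_one_ne_zero e)) ?_)
      rw [Ideal.mem_span_pair]
      refine ⟨α, β, ?_⟩
      simp only [Z] at h
      linear_combination -h

/-- The family of `3 × 3` matrix factorizations of `(g * a) * (g * b)`. -/
theorem hasInfiniteCMPlusType_of_three_by_three [IsRegularLocalRing S] {g a b w : S} (hg0 : g ≠ 0)
    (hg : Prime g) (hgm : Ideal.span {g} ≠ maximalIdeal S) (ha0 : a ≠ 0) (hb0 : b ≠ 0)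
    (ha : a ∈ maximalIdeal S) (hb : b ∈ maximalIdeal S) (hab : ∀ s, b ∣ a * s → b ∣ s)
    (hw : w ∈ maximalIdeal S) (hwg : ¬ g ∣ w) :
    HasInfiniteCMPlusType (S ⧸ Ideal.span {g * a * (g * b)}) := by
  have hba : ∀ s, a ∣ b * s → a ∣ s := by
    rintro s ⟨c, hc⟩
    obtain ⟨d, rfl⟩ := hab c ⟨s, hc.symm⟩
    exact ⟨d, mul_left_cancel₀ hb0 (by linear_combination hc)⟩
  have hP : (Ideal.span {g}).IsPrime := (Ideal.span_singleton_prime hg0).mpr hg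
  have hgm' : g ∈ maximalIdeal S := le_maximalIdeal hP.ne_top (Ideal.mem_span_singleton_self g)
  let W : ℕ → S := fun k ↦ w ^ (k + 1)
  have hWm : ∀ k, W k ∈ maximalIdeal S := fun k ↦ Ideal.pow_mem_of_mem _ hw _ k.succ_pos
  have hWg : ∀ k, ¬ g ∣ W k := fun k h ↦ hwg (hg.dvd_of_dvd_pow h)
  let φ : ℕ → Matrix (Fin 3) (Fin 3) S := fun k ↦ !![g, W k, W k; 0, g * a, 0; 0, 0, g * b]
  let ψ : ℕ → Matrix (Fin 3) (Fin 3) S :=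
    fun k ↦ !![g * a * b, -b * W k, -a * W k; 0, g * b, 0; 0, 0, g * a]
  have hφψ : ∀ k, φ k * ψ k = (g * a * (g * b)) • 1 := fun k ↦ by
    ext i j
    fin_cases i <;> fin_cases j <;> simp [φ, ψ, Matrix.mul_apply, Fin.sum_univ_three] <;> ring
  have hψφ : ∀ k, ψ k * φ k = (g * a * (g * b)) • 1 := fun k ↦ by
    ext i j
    fin_cases i <;> fin_cases j <;> simp [φ, ψ, Matrix.mul_apply, Fin.sum_univ_three] <;> ring
  refine hasInfiniteCMPlusType_of_matrix_family (by simp [hg0, ha0, hb0])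
    (Ideal.mul_mem_right _ _ (Ideal.mul_mem_right _ _ hgm')) (0 : Fin 3) φ ψ hφψ hψφ ?_ ?_ ?_ ?_
  · intro k i j
    fin_cases i <;> fin_cases j <;> simp only [φ] <;>
      first
        | exact zero_mem _
        | exact hgm'
        | exact hWm k
        | exact Ideal.mul_mem_right _ _ hgm'
  · intro k A Q hAQ
    have e00 := congrFun (congrFun hAQ 0) 0
    have e10 := congrFun (congrFun hAQ 1) 0
    have e20 := congrFun (congrFun hAQ 2) 0
    have e01 := congrFun (congrFun hAQ 0) 1
    have e11 := congrFun (congrFun hAQ 1) 1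
    have e21 := congrFun (congrFun hAQ 2) 1
    have e02 := congrFun (congrFun hAQ 0) 2
    have e12 := congrFun (congrFun hAQ 1) 2
    have e22 := congrFun (congrFun hAQ 2) 2
    simp [φ, Matrix.mul_apply, Fin.sum_univ_three] at e00 e10 e20 e01 e11 e21 e02 e12 e22
    have h10 : A 1 0 = a * Q 1 0 := mul_left_cancel₀ hg0 (by linear_combination e10)
    have h20 : A 2 0 = b * Q 2 0 := mul_left_cancel₀ hg0 (by linear_combination e20)
    -- The prime g does not divide W, so every relation W·s = g·t gives g ∣ s. This produces c, d',
    -- r and r'.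
    have h11 : W k * Q 1 0 = g * (Q 1 1 - A 1 1) :=
      mul_left_cancel₀ ha0 (by linear_combination e11 - W k * h10)
    obtain ⟨c, hc⟩ := (hg.dvd_or_dvd ⟨_, h11⟩).resolve_left (hWg k)
    have h11' : Q 1 1 - A 1 1 = W k * c :=
      mul_left_cancel₀ hg0 (by linear_combination -h11 + W k * hc)
    obtain ⟨d', hd'⟩ := (hg.dvd_or_dvd (a := W k) (b := Q 1 0 + Q 2 0)
      ⟨A 0 0 - Q 0 0, by linear_combination -e00⟩).resolve_left (hWg k)
    obtain ⟨d, hd⟩ : ∃ d, Q 2 0 = g * d := ⟨d' - c, by linear_combination hd' - hc⟩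
    have h21 : a * A 2 1 = b * (Q 2 1 - W k * d) :=
      mul_left_cancel₀ hg0 (by linear_combination e21 - W k * h20 - W k * b * hd)
    -- Here coprimality of a and b enters, and again in its symmetric form for the (1, 2) entry.
    obtain ⟨s, hs⟩ := hab _ ⟨_, h21⟩
    have h21' : Q 2 1 = a * s + W k * d :=
      mul_left_cancel₀ hb0 (by linear_combination -h21 + a * hs)
    have h12 : b * A 1 2 = a * (Q 1 2 - W k * c) :=
      mul_left_cancel₀ hg0 (by linear_combination e12 - W k * h10 - W k * a * hc)
    obtain ⟨s', hs'⟩ := hba _ ⟨_, h12⟩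
    have h12' : Q 1 2 = b * s' + W k * c :=
      mul_left_cancel₀ ha0 (by linear_combination -h12 + b * hs')
    have h22 : Q 2 2 - A 2 2 = W k * d :=
      mul_left_cancel₀ (mul_ne_zero hg0 hb0)
        (by linear_combination -e22 + W k * h20 + W k * b * hd)
    obtain ⟨r, hr⟩ := (hg.dvd_or_dvd (a := W k) (b := A 0 0 - Q 1 1 - Q 2 1)
      ⟨Q 0 1 - a * A 0 1, by linear_combination e01⟩).resolve_left (hWg k)
    obtain ⟨r', hr'⟩ := (hg.dvd_or_dvd (a := W k) (b := A 0 0 - Q 1 2 - Q 2 2)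
      ⟨Q 0 2 - b * A 0 2, by linear_combination e02⟩).resolve_left (hWg k)
    refine isUnit_det_or_fin_three A ?_ ?_ ?_ ?_ ?_
    · rw [h10]; exact Ideal.mul_mem_right _ _ ha
    · rw [h20]; exact Ideal.mul_mem_right _ _ hb
    · rw [hs']; exact Ideal.mul_mem_right _ _ ha
    · have : A 0 0 - A 1 1 = g * r + a * s + W k * (c + d) := by
        linear_combination hr + h11' + h21'
      rw [this]
      exact add_mem (add_mem (Ideal.mul_mem_right _ _ hgm') (Ideal.mul_mem_right _ _ ha))
        (Ideal.mul_mem_right _ _ (hWm k))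
    · have : A 0 0 - A 2 2 = g * r' + b * s' + W k * (c + d) := by
        linear_combination hr' + h22 + h12'
      rw [this]
      exact add_mem (add_mem (Ideal.mul_mem_right _ _ hgm') (Ideal.mul_mem_right _ _ hb))
        (Ideal.mul_mem_right _ _ (hWm k))
  · intro k
    -- At (g) the element W is a unit, so the second column eliminates the first basis vector. The
    -- other two vectors generate, and the difference of the last two columns is the relation (ga,
    -- −gb).
    refine not_isLocallyFreeOnPunctured_matrixCoker (hφψ k) hgm
      (Ideal.mul_mem_right _ _ (Ideal.mul_mem_right _ _ (Ideal.mem_span_singleton_self g)))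
      !![0, 0; 1, 0; 0, 1] (fun v ↦ ⟨W k, fun h ↦ hWg k (Ideal.mem_span_singleton.mp h),
        ![W k * v 1 - g * a * v 0, W k * v 2], ![0, v 0, 0], ?_⟩)
      (fun u v huv i ↦ ?_) (u := ![g * a, -(g * b)]) (w := ![0, 1, -1]) ?_ 0 ?_
    · ext i
      fin_cases i <;> simp [φ] <;> ring
    · have h1 := congrFun huv 1
      have h2 := congrFun huv 2
      simp [φ, Matrix.mulVec, dotProduct, Fin.sum_univ_three] at h1 h2
      rw [Ideal.mem_span_singleton]
      revert i
      rw [Fin.forall_fin_two]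
      exact ⟨⟨a * v 1, by linear_combination h1⟩, ⟨b * v 2, by linear_combination h2⟩⟩
    · ext i
      fin_cases i <;> simp [φ]
    · rintro t ht ⟨c, hc⟩
      apply ht
      rw [Ideal.mem_span_singleton]
      exact ⟨b * c, mul_left_cancel₀ (mul_ne_zero hg0 ha0) (by simp at hc; linear_combination hc)⟩
  · intro k l hkl
    refine ⟨Ideal.span {g, W l}, fun i j ↦ ?_, 0, 1, fun h ↦ ?_⟩
    · have h1 : g ∈ Ideal.span {g, W l} := Ideal.subset_span (by simp)
      have h2 : W l ∈ Ideal.span {g, W l} := Ideal.subset_span (by simp)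
      fin_cases i <;> fin_cases j <;> simp only [φ] <;>
        first
          | exact zero_mem _
          | exact h1
          | exact h2
          | exact Ideal.mul_mem_right _ _ h1
    · replace h : W k ∈ Ideal.span {g, W l} := h
      obtain ⟨α, β, h⟩ := Ideal.mem_span_pair.mp h
      obtain ⟨e, rfl⟩ : ∃ e, l = k + (e + 1) := ⟨l - k - 1, by omega⟩
      refine hWg k (Ideal.mem_span_singleton.mp
        (mem_of_isUnit_mul_mem (isUnit_one_sub_mul_pow hw β (Nat.add_one_ne_zero e)) ?_))
      rw [Ideal.mem_span_singleton]
      refine ⟨α, ?_⟩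
      simp only [W] at h ⊢
      linear_combination -h

end Families

/-! ### Reduction of the remaining case to dimension two. -/

section CaseAnalysis

open Pointwise

/-- In a two-dimensional regular local ring the primes of height one are principal. -/
theorem exists_eq_span_singleton_of_ringKrullDim_eq_two {S : Type u} [CommRing S]
    [IsRegularLocalRing S] (hdim : ringKrullDim S = 2) {P : Ideal S} [P.IsPrime]
    (hP0 : P ≠ ⊥) (hP : P ≠ maximalIdeal S) : ∃ g, P = Ideal.span {g} := by
  have hPm : P ≤ maximalIdeal S := le_maximalIdeal (Ideal.IsPrime.ne_top ‹_›)
  have hm : maximalIdeal S ≠ ⊥ := fun h ↦ hP0 (le_bot_iff.mp (h ▸ hPm))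
  obtain ⟨x, hx, hx2, -⟩ := exists_mem_maximalIdeal_notMem_sq hm
  have := isRegularLocalRing_quotient_span_singleton hx hx2
  have h1 := spanFinrank_maximalIdeal_quotient_succ_le hx hx2
  have h2 := (isRegularLocalRing_iff S).mp ‹_›
  rw [hdim] at h2
  have h3 : (maximalIdeal S).spanFinrank = 2 := by exact_mod_cast h2
  have hPIR : IsPrincipalIdealRing (S ⧸ Ideal.span {x}) := by
    refine ((tfae_of_isNoetherianRing_of_isLocalRing_of_isDomain _).out 0 5).mpr ?_
    rw [← spanFinrank_maximalIdeal_eq_finrank_cotangentSpace]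
    omega
  let π := Ideal.Quotient.mk (Ideal.span {x})
  -- S/(x) is a principal ideal domain. If x ∈ P, the image of P is zero and P = (x). Otherwise lift
  -- a generator g of the image: p − dg = xe with e ∈ P, so P ≤ (g) + 𝔪P.
  by_cases hxP : x ∈ P
  · have hle : Ideal.span {x} ≤ P := by simpa [Ideal.span_singleton_le_iff_mem] using hxP
    have hprime : (P.map π).IsPrime := Ideal.isPrime_map_quotientMk_of_isPrime hle
    have hcomap : (P.map π).comap π = P := by
      ext s
      rw [Ideal.mem_comap, Ideal.mem_quotient_iff_mem hle]
    have hbot : P.map π = ⊥ := by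
      by_contra h
      have h4 := IsPrime.to_maximal_ideal h
      have h5 := Ideal.comap_isMaximal_of_surjective π Ideal.Quotient.mk_surjective (K := P.map π)
      rw [hcomap] at h5
      exact hP (eq_maximalIdeal h5)
    refine ⟨x, ?_⟩
    rw [← hcomap, hbot, ← RingHom.ker_eq_comap_bot, Ideal.mk_ker]
  · obtain ⟨c, hc⟩ := IsPrincipalIdealRing.principal (P.map π)
    have hcP : c ∈ P.map π := by rw [hc]; exact Submodule.mem_span_singleton_self c
    obtain ⟨g, hg, rfl⟩ :=
      (Ideal.mem_map_iff_of_surjective _ Ideal.Quotient.mk_surjective).mp hcP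
    refine ⟨g, le_antisymm ?_ (by simpa [Ideal.span_singleton_le_iff_mem] using hg)⟩
    refine Submodule.le_of_le_smul_of_le_jacobson_bot (I := maximalIdeal S)
      (IsNoetherian.noetherian _) (maximalIdeal_le_jacobson _) fun p hp ↦ ?_
    have h4 : π p ∈ P.map π := Ideal.mem_map_of_mem _ hp
    rw [hc] at h4
    obtain ⟨d, hd⟩ := Submodule.mem_span_singleton.mp h4
    obtain ⟨d, rfl⟩ := Ideal.Quotient.mk_surjective d
    rw [smul_eq_mul, ← map_mul, eq_comm, Ideal.Quotient.eq, Ideal.mem_span_singleton] at hd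
    obtain ⟨e, he⟩ := hd
    have h5 : x * e ∈ P := by
      rw [← he]
      exact sub_mem hp (Ideal.mul_mem_left _ _ hg)
    have h6 : e ∈ P := (Ideal.IsPrime.mem_or_mem ‹_› h5).resolve_left hxP
    rw [show p = d * g + x * e by rw [← he]; ring]
    exact Submodule.add_mem_sup (Ideal.mul_mem_left _ _ (Ideal.mem_span_singleton_self g))
      (Submodule.smul_mem_smul hx h6)

theorem exists_isAssociatedPrime_of_not_isSMulRegular {A : Type*} [CommRing A] [IsNoetherianRing A]
    {M : Type*} [AddCommGroup M] [Module A M] {r : A} (h : ¬ IsSMulRegular M r) :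
    ∃ q, IsAssociatedPrime q M ∧ r ∈ q := by
  have h1 : r ∈ ({r | IsSMulRegular M r}ᶜ : Set A) := h
  rw [← biUnion_associatedPrimes_eq_compl_regular] at h1
  obtain ⟨q, hq, hr⟩ := Set.mem_iUnion₂.mp h1
  exact ⟨q, hq, hr⟩

theorem mem_of_isAssociatedPrime_quotSMulTop {A : Type*} [CommRing A] [IsNoetherianRing A]
    {M : Type*} [AddCommGroup M] [Module A M] {x : A} {q : Ideal A}
    (h : IsAssociatedPrime q (QuotSMulTop x M)) : x ∈ q := by
  obtain ⟨-, v, rfl⟩ := isAssociatedPrime_iff.mp h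
  obtain ⟨v, rfl⟩ := Submodule.Quotient.mk_surjective _ v
  rw [Submodule.mem_colon_singleton, Submodule.mem_bot, ← Submodule.Quotient.mk_smul,
    Submodule.Quotient.mk_eq_zero]
  exact Submodule.smul_mem_pointwise_smul v x ⊤ trivial

theorem mk_quotSMulTop_eq_zero_iff {A : Type*} [CommRing A] {M : Type*} [AddCommGroup M]
    [Module A M] (r : A) (v : M) :
    (Submodule.Quotient.mk v : QuotSMulTop r M) = 0 ↔ ∃ u, r • u = v := by
  rw [Submodule.Quotient.mk_eq_zero, Submodule.mem_smul_pointwise_iff_exists]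
  simp

theorem mk_mk_quotSMulTop_eq_zero_iff {A : Type*} [CommRing A] (x y s : A) :
    (Submodule.Quotient.mk (Submodule.Quotient.mk s : QuotSMulTop x A) :
      QuotSMulTop y (QuotSMulTop x A)) = 0 ↔ s ∈ Ideal.span {x, y} := by
  rw [mk_quotSMulTop_eq_zero_iff, Ideal.mem_span_pair]
  constructor
  · rintro ⟨u, hu⟩
    obtain ⟨u, rfl⟩ := Submodule.Quotient.mk_surjective _ u
    rw [← Submodule.Quotient.mk_smul, eq_comm, ← sub_eq_zero, ← Submodule.Quotient.mk_sub,
      mk_quotSMulTop_eq_zero_iff] at hu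
    obtain ⟨c, hc⟩ := hu
    rw [smul_eq_mul, smul_eq_mul] at hc
    exact ⟨c, u, by linear_combination hc⟩
  · rintro ⟨c, u, rfl⟩
    refine ⟨Submodule.Quotient.mk u, ?_⟩
    rw [← Submodule.Quotient.mk_smul, eq_comm, ← sub_eq_zero, ← Submodule.Quotient.mk_sub,
      mk_quotSMulTop_eq_zero_iff]
    exact ⟨c, by rw [smul_eq_mul, smul_eq_mul]; ring⟩

/-- If `P` is the only nonmaximal prime containing `(x, y)`, and `(x, y)` has a section
supported at the closed point, then the dimension is at most two. -/
theorem not_hasDepthGE_three {S : Type u} [CommRing S] [IsLocalRing S] [IsDomain S]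
    [IsNoetherianRing S] {x y : S} (hx0 : x ≠ 0) (hx : x ∈ maximalIdeal S)
    (hy : y ∈ maximalIdeal S) {P : Ideal S}
    (huniq : ∀ q : Ideal S, q.IsPrime → x ∈ q → y ∈ q → q = P ∨ q = maximalIdeal S)
    {z : S} (hz : z ∉ Ideal.span {x, y})
    (hzw : ∀ w ∈ maximalIdeal S, ∃ k : ℕ, z * w ^ k ∈ Ideal.span {x, y}) (k : ℕ) :
    ¬ HasDepthGE S S (k + 3) := by
  intro h
  have hT := h.quotSMulTop hx (IsSMulRegular.of_ne_zero hx0)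
  -- If x, y is a regular sequence, the next regular element contradicts the torsion of z. Otherwise
  -- an associated prime of S/(x) contains y, and two more regular elements give three nested primes
  -- over (x, y), where only two exist.
  by_cases hyreg : IsSMulRegular (QuotSMulTop x S) y
  · obtain ⟨rs, hlen, hmem, hreg⟩ := hT.quotSMulTop hy hyreg
    match rs, hlen with
    | r :: rs, _ =>
      rw [isRegular_cons_iff] at hreg
      obtain ⟨e, he⟩ := hzw r (hmem r (by simp))
      apply hz
      rw [← mk_mk_quotSMulTop_eq_zero_iff] at he ⊢
      refine (hreg.1.pow e).right_eq_zero_of_smul ?_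
      rw [← he, mul_comm z, ← smul_eq_mul, Submodule.Quotient.mk_smul, Submodule.Quotient.mk_smul]
  · obtain ⟨q, hq, hyq⟩ := exists_isAssociatedPrime_of_not_isSMulRegular hyreg
    have hxq := mem_of_isAssociatedPrime_quotSMulTop hq
    obtain ⟨rs, hlen, hmem, hreg⟩ := hT
    match rs, hlen with
    | r₁ :: r₂ :: rs, _ =>
      rw [isRegular_cons_iff, isRegular_cons_iff] at hreg
      obtain ⟨q₁, hq₁, hlt₁⟩ := hq.exists_lt_of_isSMulRegular (hmem r₁ (by simp)) hreg.1
      obtain ⟨q₂, hq₂, hlt₂⟩ := hq₁.exists_lt_of_isSMulRegular (hmem r₂ (by simp)) hreg.2.1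
      have h₁ : q₁ ≠ maximalIdeal S :=
        ne_of_lt (hlt₂.trans_le (le_maximalIdeal hq₂.isPrime.ne_top))
      have h₀ : q ≠ maximalIdeal S :=
        ne_of_lt (hlt₁.trans_le (le_maximalIdeal hq₁.isPrime.ne_top))
      have e₀ := (huniq q hq.isPrime hxq hyq).resolve_right h₀
      have e₁ := (huniq q₁ hq₁.isPrime (hlt₁.le hxq) (hlt₁.le hyq)).resolve_right h₁
      exact hlt₁.ne (e₀.trans e₁.symm)

theorem exists_isPrime_ne_maximalIdeal {S : Type u} [CommRing S] [IsLocalRing S] {I : Ideal S}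
    (hI : I ≤ maximalIdeal S) (h : ¬ (I.IsPrimary ∧ I.radical = maximalIdeal S)) :
    ∃ P : Ideal S, P.IsPrime ∧ P ≠ maximalIdeal S ∧ I ≤ P := by
  by_contra! H
  have hrad : I.radical = maximalIdeal S := by
    rw [Ideal.radical_eq_sInf]
    refine le_antisymm (sInf_le ⟨hI, (maximalIdeal.isMaximal S).isPrime⟩)
      (le_sInf fun P ⟨hIP, hP⟩ ↦ ?_)
    by_contra hne
    exact H P hP (fun h ↦ hne h.ge) hIP
  exact h ⟨Ideal.isPrimary_of_isMaximal_radical (hrad ▸ maximalIdeal.isMaximal S), hrad⟩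

end CaseAnalysis

/-! ### The main theorem. -/

theorem theorem22 (S : Type u) [CommRing S] [IsRegularLocalRing S] (x y : S)
    (hx : x ∈ maximalIdeal S) (hy : y ∈ maximalIdeal S)
    (hxy : x * y ≠ 0)
    (hprime : ¬ (Ideal.span {x, y}).IsPrime)
    (hprimary : ¬ ((Ideal.span {x, y}).IsPrimary ∧
      (Ideal.span {x, y}).radical = maximalIdeal S)) :
    HasInfiniteCMPlusType (S ⧸ Ideal.span {x * y}) := by
  have hx0 : x ≠ 0 := left_ne_zero_of_mul hxy
  have hspan : ∀ q : Ideal S, Ideal.span {x, y} ≤ q ↔ x ∈ q ∧ y ∈ q := fun q ↦ by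
    simp [Ideal.span_le, Set.insert_subset_iff]
  by_cases H : ∃ P : Ideal S, P.IsPrime ∧ P ≠ maximalIdeal S ∧ x ∈ P ∧ y ∈ P ∧
      ∃ z ∈ P, ∃ w ∈ maximalIdeal S, ∀ k, z * w ^ k ∉ Ideal.span {x, y}
  · obtain ⟨P, hPp, hPm, hxP, hyP, z, hz, w, hw, hzw⟩ := H
    exact hasInfiniteCMPlusType_of_two_by_two hxy hPm hxP hyP hz hw hzw
  push Not at H
  obtain ⟨P, hP, hPm, hIP⟩ :=
    exists_isPrime_ne_maximalIdeal ((hspan _).mpr ⟨hx, hy⟩) hprimary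
  obtain ⟨hxP, hyP⟩ := (hspan P).mp hIP
  have hPle : P ≤ maximalIdeal S := le_maximalIdeal hP.ne_top
  have hcontain : ∀ q q' : Ideal S, q.IsPrime → q'.IsPrime → q ≠ maximalIdeal S →
      x ∈ q → y ∈ q → x ∈ q' → y ∈ q' → q ≤ q' := by
    intro q q' hq hq' hqm hxq hyq hxq' hyq' z hz
    -- Taking w = z shows that q lies in the radical of (x, y).
    obtain ⟨k, hk⟩ := H q hq hqm hxq hyq z hz z (le_maximalIdeal hq.ne_top hz)
    rw [← pow_succ'] at hk
    exact hq'.mem_of_pow_mem _ ((hspan q').mpr ⟨hxq', hyq'⟩ hk)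
  have huniq : ∀ q : Ideal S, q.IsPrime → x ∈ q → y ∈ q → q = P ∨ q = maximalIdeal S := by
    intro q hq hxq hyq
    by_cases hqm : q = maximalIdeal S
    · exact .inr hqm
    · exact .inl (le_antisymm (hcontain q P hq hP hqm hxq hyq hxP hyP)
        (hcontain P q hP hq hPm hxP hyP hxq hyq))
  have hIneP : ¬ P ≤ Ideal.span {x, y} := fun h ↦ hprime (le_antisymm hIP h ▸ hP)
  obtain ⟨z, hzP, hz⟩ := Set.not_subset.mp hIneP
  have hP0 : P ≠ ⊥ := fun h ↦ hx0 (by simpa [h] using hxP)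
  obtain ⟨n, hn, hdepth⟩ := IsRegularLocalRing.isCMLocal S
  have hn2 : n = 2 := by
    have h1 := Ideal.height_add_one_le_of_lt_of_isPrime (bot_lt_iff_ne_bot.mpr hP0)
    have h2 := Ideal.height_add_one_le_of_lt_of_isPrime (lt_of_le_of_ne hPle hPm)
    rw [← maximalIdeal_height_eq_ringKrullDim] at hn
    have h3 : (maximalIdeal S).height = n := by exact_mod_cast hn
    rw [h3] at h2
    have h4 : (2 : ℕ∞) ≤ n := by
      calc (2 : ℕ∞) = 0 + 1 + 1 := by norm_num
        _ ≤ (⊥ : Ideal S).height + 1 + 1 := by gcongr; exact zero_le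
        _ ≤ P.height + 1 := by gcongr
        _ ≤ n := h2
    have h5 : 2 ≤ n := by exact_mod_cast h4
    by_contra hne
    obtain ⟨k, rfl⟩ : ∃ k, n = k + 3 := ⟨n - 3, by omega⟩
    exact not_hasDepthGE_three hx0 hx hy huniq hz
      (fun w hw ↦ H P hP hPm hxP hyP z hzP w hw) k hdepth
  subst hn2
  obtain ⟨g, rfl⟩ := exists_eq_span_singleton_of_ringKrullDim_eq_two hn hP0 hPm
  have hg0 : g ≠ 0 := fun h ↦ hP0 (by simp [h])
  have hgp : Prime g := (Ideal.span_singleton_prime hg0).mp hP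
  obtain ⟨a, rfl⟩ := Ideal.mem_span_singleton.mp hxP
  obtain ⟨b, rfl⟩ := Ideal.mem_span_singleton.mp hyP
  have hgI : g ∉ Ideal.span {g * a, g * b} := fun h ↦
    hIneP (by simpa [Ideal.span_singleton_le_iff_mem] using h)
  have ha : a ∈ maximalIdeal S := by
    by_contra h
    rw [mem_maximalIdeal, mem_nonunits_iff, not_not] at h
    exact hgI (mem_of_isUnit_mul_mem h (Ideal.subset_span (by simp)))
  have hb : b ∈ maximalIdeal S := by
    by_contra h
    rw [mem_maximalIdeal, mem_nonunits_iff, not_not] at h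
    exact hgI (mem_of_isUnit_mul_mem h (Ideal.subset_span (by simp)))
  have ha0 : a ≠ 0 := by rintro rfl; simp at hxy
  have hb0 : b ≠ 0 := by rintro rfl; simp at hxy
  obtain ⟨w, hw, hwg⟩ := Set.not_subset.mp fun h ↦ hPm (le_antisymm hPle h)
  replace hwg : ¬ g ∣ w := fun h ↦ hwg (Ideal.mem_span_singleton.mpr h)
  refine hasInfiniteCMPlusType_of_three_by_three hg0 hgp hPm ha0 hb0 ha hb ?_ hw hwg
  -- If a is a zero divisor modulo b, an associated prime contains both. Depth makes it nonmaximal,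
  -- so it is (g). Then x, y ∈ (g²), while g·w^k ∈ (x, y) for some k, which forces g ∣ w.
  have hreg : IsSMulRegular (QuotSMulTop b S) a := by
    by_contra hreg
    obtain ⟨q, hq, haq⟩ := exists_isAssociatedPrime_of_not_isSMulRegular hreg
    have hbq := mem_of_isAssociatedPrime_quotSMulTop hq
    obtain ⟨rs, hlen, hmem, hrs⟩ := hdepth.quotSMulTop hb (IsSMulRegular.of_ne_zero hb0)
    match rs, hlen with
    | r :: rs, _ =>
      rw [isRegular_cons_iff] at hrs
      obtain ⟨q₁, hq₁, hlt⟩ := hq.exists_lt_of_isSMulRegular (hmem r (by simp)) hrs.1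
      obtain rfl := (huniq q hq.isPrime (Ideal.mul_mem_left _ _ haq)
        (Ideal.mul_mem_left _ _ hbq)).resolve_right
        (ne_of_lt (hlt.trans_le (le_maximalIdeal hq₁.isPrime.ne_top)))
      obtain ⟨a', rfl⟩ := Ideal.mem_span_singleton.mp haq
      obtain ⟨b', rfl⟩ := Ideal.mem_span_singleton.mp hbq
      obtain ⟨k, hk⟩ := H _ hP hPm hxP hyP g (Ideal.mem_span_singleton_self g) w hw
      obtain ⟨c, d, hcd⟩ := Ideal.mem_span_pair.mp hk
      refine hwg (hgp.dvd_of_dvd_pow (n := k) ⟨c * a' + d * b', mul_left_cancel₀ hg0 ?_⟩)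
      linear_combination -hcd
  rintro s ⟨c, hc⟩
  have h1 : (Submodule.Quotient.mk s : QuotSMulTop b S) = 0 := by
    refine hreg.right_eq_zero_of_smul ?_
    rw [← Submodule.Quotient.mk_smul, mk_quotSMulTop_eq_zero_iff]
    exact ⟨c, hc.symm⟩
  obtain ⟨u, hu⟩ := (mk_quotSMulTop_eq_zero_iff b s).mp h1
  exact ⟨u, hu.symm⟩
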